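/- Let $\mathbb{T}=\mathbb{R}/\mathbb{Z}$ and let $X\in C^2(\mathbb{T};\mathbb{R}^3)$ be a closed curve of length $1$ parameterized by arclength, with $|X(s)-X(t)|\ge c_\Gamma|s-t|$ for all $s,t\in\mathbb{T}$, where $c_\Gamma>0$ and $|s-t|$ is the distance on $\mathbb{T}$. Put $\kappa_{\max}=\max_s|X''(s)|$. Let $(e_t,e_{n_1},e_{n_2})$, $e_t=X'$, be a $C^1$ orthonormal frame along $X$ (periodic in $s$), write $X''=\kappa_1e_{n_1}+\kappa_2e_{n_2}$ and $e_\rho(s,\theta)=\cos\theta\,e_{n_1}(s)+\sin\theta\,e_{n_2}(s)$. Let $r_{\max}>0$ be such that every point at distance less than $r_{\max}$ from the curve can be written uniquely as $X(s)+\rho e_\rho(s,\theta)$ with $s\in\mathbb{T}$, $0\le\rho<r_{\max}$ (with $\theta$ irrelevant if $\rho=0$), and let $0<\epsilon<r_{\max}/4$. For $f\in C^1(\mathbb{T};\mathbb{R}^3)$ define, for $x$ off the curve and with $R=x-X(t)$, $$u^{SB}(x)=\frac1{8\pi}\int_{\mathbb{T}}\Big(\frac{I}{|R|}+\frac{RR^T}{|R|^3}+\frac{\epsilon^2}{2}\Big(\frac{I}{|R|^3}-\frac{3RR^T}{|R|^5}\Big)\Big)f(t)\,dt,\qquad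 p^{SB}(x)=\frac1{4\pi}\int_{\mathbb{T}}\frac{R\cdot f(t)}{|R|^3}\,dt,$$ let $\sigma^{SB}=-p^{SB}I+\nabla u^{SB}+(\nabla u^{SB})^T$, and let $$f^{SB}(s)=\int_0^{2\pi}\sigma^{SB}n\Big|_{x=X(s)+\epsilon e_\rho(s,\theta)}\,\mathcal{J}_\epsilon(s,\theta)\,d\theta,\qquad n=-e_\rho(s,\theta),\quad \mathcal{J}_\epsilon=\epsilon\big(1-\epsilon(\kappa_1(s)\cos\theta+\kappa_2(s)\sin\theta)\big).$$ Then for all $s\in\mathbb{T}$ $$|f^{SB}(s)-f(s)|\le c_\kappa\,\epsilon\,\|f\|_{C^1(\mathbb{T})},\qquad \|f\|_{C^1(\mathbb{T})}=\max_{\mathbb{T}}|f|+\max_{\mathbb{T}}|f'|,$$ where the constant $c_\kappa$ depends only on $c_\Gamma$ and $\kappa_{\max}$. -/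

import Mathlib

open scoped RealInnerProductSpace

noncomputable section

namespace SlenderBody

/-- Euclidean three-space. -/
abbrev E3 : Type := EuclideanSpace ℝ (Fin 3)

/-! ### Geometry of the fiber

Functions on the circle `ℝ / ℤ` are represented by functions on `ℝ` of period `1`. -/

/-- `X` is a closed `C²` curve of length `1`, parameterized by arclength. -/
structure IsCenterline (X : ℝ → E3) : Prop where
  contDiff : ContDiff ℝ 2 X
  periodic : Function.Periodic X 1
  arclength : ∀ s, ‖deriv X s‖ = 1

/-- `|X(s) - X(t)| ≥ cΓ |s - t|`, where `|s - t|` is the distance on the circle `ℝ / ℤ`. -/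
def NonSelfIntersecting (X : ℝ → E3) (cΓ : ℝ) : Prop :=
  0 < cΓ ∧ ∀ s t : ℝ, cΓ * ‖((s - t : ℝ) : AddCircle (1 : ℝ))‖ ≤ ‖X s - X t‖

/-- The curvature `κ(s) = |X''(s)|`. -/
def curvature (X : ℝ → E3) (s : ℝ) : ℝ := ‖deriv (deriv X) s‖

/-- The maximal curvature `κ_max` of the centerline. -/
def maxCurvature (X : ℝ → E3) : ℝ := ⨆ s : ℝ, curvature X s

/-- `(X', n₁, n₂)` is a periodic `C¹` orthonormal frame along the centerline. -/
structure IsNormalFrame (X n₁ n₂ : ℝ → E3) : Prop where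
  contDiff₁ : ContDiff ℝ 1 n₁
  contDiff₂ : ContDiff ℝ 1 n₂
  periodic₁ : Function.Periodic n₁ 1
  periodic₂ : Function.Periodic n₂ 1
  orthonormal : ∀ s, Orthonormal ℝ ![deriv X s, n₁ s, n₂ s]

/-- The radial unit vector `e_ρ(s,θ) = cos θ n₁(s) + sin θ n₂(s)`. -/
def eRho (n₁ n₂ : ℝ → E3) (s θ : ℝ) : E3 :=
  Real.cos θ • n₁ s + Real.sin θ • n₂ s

/-- Every point at distance less than `r` from the centerline is uniquely of the form
`X(s) + ρ e_ρ(s,θ)` with `s` in the circle and `0 ≤ ρ < r`. (Once `s` is unique, so is the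
vector `ρ e_ρ(s,θ) = x - X(s)`, hence `ρ`, and for `ρ ≠ 0` the angle `θ` modulo `2π`.) -/
def IsTubeRadius (X n₁ n₂ : ℝ → E3) (r : ℝ) : Prop :=
  0 < r ∧ ∀ x : E3, Metric.infDist x (Set.range X) < r →
    ∃! s : ℝ, s ∈ Set.Ico (0 : ℝ) 1 ∧
      ∃ ρ θ : ℝ, 0 ≤ ρ ∧ ρ < r ∧ x = X s + ρ • eRho n₁ n₂ s θ

/-- The point `X(s) + ε e_ρ(s,θ)` of the fiber surface. -/
def surfacePoint (X n₁ n₂ : ℝ → E3) (ε s θ : ℝ) : E3 :=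
  X s + ε • eRho n₁ n₂ s θ

/-- The surface Jacobian `ε (1 - ε (κ₁ cos θ + κ₂ sin θ))`, where `κ₁`, `κ₂` are the coefficients
of `X'' = κ₁ n₁ + κ₂ n₂`. -/
def jacobian (X n₁ n₂ : ℝ → E3) (ε s θ : ℝ) : ℝ :=
  ε * (1 - ε * (⟪deriv (deriv X) s, n₁ s⟫ * Real.cos θ
    + ⟪deriv (deriv X) s, n₂ s⟫ * Real.sin θ))

/-! ### The slender body approximation -/

/-- The Stokeslet `S(R) = I / |R| + R Rᵀ / |R|³`, applied to the vector `g`. -/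
def stokeslet (R g : E3) : E3 :=
  (1 / ‖R‖) • g + (⟪R, g⟫ / ‖R‖ ^ 3) • R

/-- The doublet `D(R) = I / |R|³ - 3 R Rᵀ / |R|⁵`, applied to the vector `g`. -/
def doublet (R g : E3) : E3 :=
  (1 / ‖R‖ ^ 3) • g - (3 * ⟪R, g⟫ / ‖R‖ ^ 5) • R

/-- The slender body velocity field (viscosity `1`). -/
def velocitySB (X f : ℝ → E3) (ε : ℝ) (x : E3) : E3 :=
  (1 / (8 * Real.pi)) •
    ∫ t in (0 : ℝ)..1, (stokeslet (x - X t) (f t) + (ε ^ 2 / 2) • doublet (x - X t) (f t))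

/-- The slender body pressure field. -/
def pressureSB (X f : ℝ → E3) (x : E3) : ℝ :=
  (1 / (4 * Real.pi)) * ∫ t in (0 : ℝ)..1, ⟪x - X t, f t⟫ / ‖x - X t‖ ^ 3

/-- The strain rate `(∇u + (∇u)ᵀ) / 2` of a velocity field. -/
def strainRate (u : E3 → E3) (x : E3) : E3 →L[ℝ] E3 :=
  (1 / 2 : ℝ) • (fderiv ℝ u x + ContinuousLinearMap.adjoint (fderiv ℝ u x))

/-- The stress tensor `-p I + 2 E(u)` of a flow with velocity `u` and pressure `p`. -/
def stress (u : E3 → E3) (p : E3 → ℝ) (x : E3) : E3 →L[ℝ] E3 :=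
  -(p x) • ContinuousLinearMap.id ℝ E3 + (2 : ℝ) • strainRate u x

/-- The total force `f^SB(s) = ∫₀^{2π} σ^SB n J_ε(s,θ) dθ` over the cross section at `s`, with
`n = -e_ρ` the unit normal pointing into the fiber. -/
def forceSB (X n₁ n₂ f : ℝ → E3) (ε s : ℝ) : E3 :=
  ∫ θ in (0 : ℝ)..(2 * Real.pi),
    jacobian X n₁ n₂ ε s θ •
      stress (velocitySB X f ε) (pressureSB X f) (surfacePoint X n₁ n₂ ε s θ)
        (-(eRho n₁ n₂ s θ))

/-- The norm `max |f| + max |f'|` of `C¹(ℝ / ℤ)`. -/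
def normC1 (f : ℝ → E3) : ℝ :=
  (⨆ s : ℝ, ‖f s‖) + ⨆ s : ℝ, ‖deriv f s‖

end SlenderBody

end

noncomputable section

namespace SlenderBody

/-! ### Suprema over a period -/

/-! Differentiating under the integral turns the surface traction into one integral over the curve
of an explicit kernel in `R = V + ε e`, with `V = X s - X t` and `e = e_ρ(s,θ)`
(`stress_apply_neg`). It is compared with the kernel of the straight filament along the tangent `T`,
where `R` becomes `τ T + ε e` with `τ = s - t`, at distance `ρ = √(ε² + τ²)`, and `f t` becomes `f
s`.

The kernel has size `1/ρ²`, and `∫ ρ⁻² dτ ≤ π/ε`. Since the Jacobian is `ε + O(κ ε²)`, a kernel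
error `O(ε/ρ² + 1)` is affordable: it integrates to `O(1)` and the Jacobian makes it `O(ε)`.
Curvature and the variation of `f` produce such errors, except for terms of size `κ/ρ` containing
`⟪e, V⟫`, which would cost `ε log(1/ε)`. Those are odd in `e`, up to an affordable remainder, so the
integral over `θ` removes them (`oddKernel`, `norm_tractionKernel_sub_le`).

What remains is even in `e` and is integrated exactly with `w = τ/√(ε² + τ²)`. After averaging over
`θ` it is a polynomial in `w` that equals `f s` at `w = 1`; truncating the filament at `|τ| = 1/2`
costs only `O(ε)` (`norm_straight_sub_le`).

The tube hypothesis enters through two geometric facts: surface points stay at distance at least `ε`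
from the whole curve, and `r ≤ 1`, which makes `ε` at most `1/4`. -/

theorem le_iSup_norm_of_periodic {E : Type*} [NormedAddCommGroup E] {g : ℝ → E}
    (hg : Continuous g) (hp : Function.Periodic g 1) (s : ℝ) : ‖g s‖ ≤ ⨆ t : ℝ, ‖g t‖ := by
  have hp' : Function.Periodic (fun t => ‖g t‖) 1 := fun t => by simp only [hp t]
  -- A real supremum of an unbounded family is `0` by convention; continuity on a compact period
  -- rules this out.
  exact le_ciSup (hp'.compact_of_continuous one_ne_zero hg.norm).bddAbove s

theorem periodic_deriv {E : Type*} [NormedAddCommGroup E] [NormedSpace ℝ E] {g : ℝ → E}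
    (hp : Function.Periodic g 1) : Function.Periodic (deriv g) 1 := by
  intro s
  rw [← deriv_comp_add_const g 1 s]
  exact congrArg (fun h => deriv h s) (funext hp)

theorem norm_sub_le_of_norm_deriv_le {E : Type*} [NormedAddCommGroup E] [NormedSpace ℝ E]
    {g : ℝ → E} (hg : Differentiable ℝ g) {C : ℝ} (hC : ∀ s, ‖deriv g s‖ ≤ C) (s t : ℝ) :
    ‖g t - g s‖ ≤ C * |t - s| :=
  convex_univ.norm_image_sub_le_of_norm_deriv_le (fun x _ => hg x) (fun x _ => hC x)
    (Set.mem_univ s) (Set.mem_univ t)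

theorem norm_le_normC1 {f : ℝ → E3} (hf : ContDiff ℝ 1 f) (hp : Function.Periodic f 1) (s : ℝ) :
    ‖f s‖ ≤ normC1 f := by
  have h1 := le_iSup_norm_of_periodic hf.continuous hp s
  have h2 : 0 ≤ ⨆ t : ℝ, ‖deriv f t‖ := Real.iSup_nonneg fun _ => norm_nonneg _
  unfold normC1; linarith

theorem norm_sub_le_normC1 {f : ℝ → E3} (hf : ContDiff ℝ 1 f) (hp : Function.Periodic f 1)
    (s t : ℝ) : ‖f t - f s‖ ≤ normC1 f * |t - s| := by
  refine norm_sub_le_of_norm_deriv_le (hf.differentiable one_ne_zero) (fun x => ?_) s t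
  have h1 := le_iSup_norm_of_periodic (hf.continuous_deriv le_rfl) (periodic_deriv hp) x
  have h2 : 0 ≤ ⨆ t : ℝ, ‖f t‖ := Real.iSup_nonneg fun _ => norm_nonneg _
  unfold normC1; linarith

theorem normC1_nonneg (f : ℝ → E3) : 0 ≤ normC1 f :=
  add_nonneg (Real.iSup_nonneg fun _ => norm_nonneg _) (Real.iSup_nonneg fun _ => norm_nonneg _)

theorem maxCurvature_nonneg (X : ℝ → E3) : 0 ≤ maxCurvature X :=
  Real.iSup_nonneg fun _ => norm_nonneg _

/-! ### The centerline -/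

namespace IsCenterline

variable {X : ℝ → E3} (hX : IsCenterline X)
include hX

theorem continuous : Continuous X := hX.contDiff.continuous

theorem differentiable : Differentiable ℝ X := hX.contDiff.differentiable two_ne_zero

theorem contDiff_deriv : ContDiff ℝ 1 (deriv X) :=
  ((contDiff_succ_iff_deriv (n := 1)).1 hX.contDiff).2.2

theorem norm_deriv_deriv_le (s : ℝ) : ‖deriv (deriv X) s‖ ≤ maxCurvature X :=
  le_iSup_norm_of_periodic (hX.contDiff_deriv.continuous_deriv le_rfl)
    (periodic_deriv (periodic_deriv hX.periodic)) s

theorem norm_sub_le (s t : ℝ) : ‖X s - X t‖ ≤ |s - t| := by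
  simpa using norm_sub_le_of_norm_deriv_le hX.differentiable (fun x => (hX.arclength x).le) t s

/-- Mean value inequality for `y ↦ X y - y X'(s)`, whose derivative between `s` and `t` is at most
`κ |t - s|`. The sharp factor `1/2` is not needed. -/
theorem norm_sub_sub_smul_deriv_le (s t : ℝ) :
    ‖X s - X t - (s - t) • deriv X s‖ ≤ maxCurvature X * (s - t) ^ 2 := by
  have hd : ∀ y ∈ Set.uIcc s t, HasDerivWithinAt (fun y => X y - y • deriv X s)
      (deriv X y - deriv X s) (Set.uIcc s t) y := by
    intro y _
    have h1 := (hX.differentiable y).hasDerivAt.sub ((hasDerivAt_id y).smul_const (deriv X s))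
    rw [one_smul] at h1
    exact h1.hasDerivWithinAt
  have hb : ∀ y ∈ Set.uIcc s t, ‖deriv X y - deriv X s‖ ≤ maxCurvature X * |t - s| := by
    intro y hy
    refine (norm_sub_le_of_norm_deriv_le (hX.contDiff_deriv.differentiable one_ne_zero)
      hX.norm_deriv_deriv_le s y).trans ?_
    exact mul_le_mul_of_nonneg_left (Set.abs_sub_left_of_mem_uIcc hy) (maxCurvature_nonneg X)
  have h := (convex_uIcc s t).norm_image_sub_le_of_norm_hasDerivWithin_le hd hb
    Set.right_mem_uIcc Set.left_mem_uIcc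
  have e1 : X s - s • deriv X s - (X t - t • deriv X s) = X s - X t - (s - t) • deriv X s := by
    module
  rw [e1] at h
  refine h.trans (le_of_eq ?_)
  rw [Real.norm_eq_abs, abs_sub_comm t s, mul_assoc, abs_mul_abs_self]; ring

theorem apply_fract (s : ℝ) : X (Int.fract s) = X s := by
  have h := hX.periodic.sub_int_mul_eq (x := s) ⌊s⌋
  rwa [mul_one] at h

end IsCenterline

/-! ### The frame and the tube -/

namespace IsNormalFrame

variable {X n₁ n₂ : ℝ → E3} (hn : IsNormalFrame X n₁ n₂)
include hn

theorem norm_left (s : ℝ) : ‖n₁ s‖ = 1 := by simpa using (hn.orthonormal s).1 1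

theorem norm_right (s : ℝ) : ‖n₂ s‖ = 1 := by simpa using (hn.orthonormal s).1 2

theorem inner_left_right (s : ℝ) : ⟪n₁ s, n₂ s⟫ = 0 := by
  simpa using (hn.orthonormal s).2 (show (1 : Fin 3) ≠ 2 by decide)

theorem inner_tangent_left (s : ℝ) : ⟪deriv X s, n₁ s⟫ = 0 := by
  simpa using (hn.orthonormal s).2 (show (0 : Fin 3) ≠ 1 by decide)

theorem inner_tangent_right (s : ℝ) : ⟪deriv X s, n₂ s⟫ = 0 := by
  simpa using (hn.orthonormal s).2 (show (0 : Fin 3) ≠ 2 by decide)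

theorem expansion (s : ℝ) (v : E3) :
    v = ⟪deriv X s, v⟫ • deriv X s + ⟪n₁ s, v⟫ • n₁ s + ⟪n₂ s, v⟫ • n₂ s := by
  have hs := hn.orthonormal s
  let b := (basisOfOrthonormalOfCardEqFinrank hs (by simp)).toOrthonormalBasis
    (by simpa using hs)
  have hb : ⇑b = ![deriv X s, n₁ s, n₂ s] := by simp [b]
  have h := b.sum_repr' v
  rw [hb] at h
  simpa [Fin.sum_univ_three] using h.symm

theorem inner_tangent_eRho (s θ : ℝ) : ⟪deriv X s, eRho n₁ n₂ s θ⟫ = 0 := by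
  simp [eRho, inner_add_right, inner_smul_right, hn.inner_tangent_left, hn.inner_tangent_right]

theorem norm_eRho (s θ : ℝ) : ‖eRho n₁ n₂ s θ‖ = 1 := by
  have h : ‖eRho n₁ n₂ s θ‖ ^ 2 = 1 := by
    rw [eRho, norm_add_sq_real, norm_smul, norm_smul, inner_smul_left, inner_smul_right,
      hn.inner_left_right, hn.norm_left, hn.norm_right]
    simp
  have h0 := norm_nonneg (eRho n₁ n₂ s θ)
  nlinarith

/-- Polar coordinates in the normal plane, with the complex argument as angle; `v = 0` needs no
separate case. -/
theorem exists_eq_smul_eRho (s : ℝ) {v : E3} (hv : ⟪deriv X s, v⟫ = 0) :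
    ∃ θ : ℝ, v = ‖v‖ • eRho n₁ n₂ s θ := by
  have hexp := hn.expansion s v
  rw [hv, zero_smul, zero_add] at hexp
  set α := ⟪n₁ s, v⟫
  set β := ⟪n₂ s, v⟫
  have hz : ‖v‖ = ‖(⟨α, β⟩ : ℂ)‖ := by
    have h : ‖v‖ ^ 2 = ‖(⟨α, β⟩ : ℂ)‖ ^ 2 := by
      rw [hexp, norm_add_sq_real, norm_smul, norm_smul, inner_smul_left, inner_smul_right,
        hn.inner_left_right, hn.norm_left, hn.norm_right, ← Complex.normSq_eq_norm_sq,
        Complex.normSq_mk]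
      simp [sq]
    exact (sq_eq_sq₀ (norm_nonneg _) (norm_nonneg _)).1 h
  refine ⟨Complex.arg ⟨α, β⟩, ?_⟩
  rw [hz, eRho, smul_add, smul_smul, smul_smul, Complex.norm_mul_cos_arg,
    Complex.norm_mul_sin_arg]
  exact hexp

end IsNormalFrame

/-! ### Nearest and farthest points of the curve, and consequences of tube uniqueness -/

theorem eRho_add_pi (n₁ n₂ : ℝ → E3) (s θ : ℝ) :
    eRho n₁ n₂ s (θ + Real.pi) = -eRho n₁ n₂ s θ := by
  simp [eRho, Real.cos_add_pi, Real.sin_add_pi]; abel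

theorem exists_norm_sub_le {X : ℝ → E3} (hX : IsCenterline X) (x : E3) :
    ∃ t₀ ∈ Set.Ico (0 : ℝ) 1, ∀ t, ‖x - X t₀‖ ≤ ‖x - X t‖ := by
  obtain ⟨t₁, _, h⟩ := isCompact_Icc.exists_isMinOn (Set.nonempty_Icc.2 zero_le_one)
    (f := fun t => ‖x - X t‖) (continuous_const.sub hX.continuous).norm.continuousOn
  refine ⟨Int.fract t₁, ⟨Int.fract_nonneg _, Int.fract_lt_one _⟩, fun t => ?_⟩
  rw [hX.apply_fract, ← hX.apply_fract t]
  exact h ⟨Int.fract_nonneg t, (Int.fract_lt_one t).le⟩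

theorem exists_le_norm_sub {X : ℝ → E3} (hX : IsCenterline X) (x : E3) :
    ∃ t₀ ∈ Set.Ico (0 : ℝ) 1, ∀ t, ‖x - X t‖ ≤ ‖x - X t₀‖ := by
  obtain ⟨t₁, _, h⟩ := isCompact_Icc.exists_isMaxOn (Set.nonempty_Icc.2 zero_le_one)
    (f := fun t => ‖x - X t‖) (continuous_const.sub hX.continuous).norm.continuousOn
  refine ⟨Int.fract t₁, ⟨Int.fract_nonneg _, Int.fract_lt_one _⟩, fun t => ?_⟩
  rw [hX.apply_fract, ← hX.apply_fract t]
  exact h ⟨Int.fract_nonneg t, (Int.fract_lt_one t).le⟩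

theorem inner_deriv_eq_zero_of_isLocalExtr {X : ℝ → E3} (hX : IsCenterline X) (x : E3) {t₀ : ℝ}
    (h : IsLocalExtr (fun t => ‖x - X t‖ ^ 2) t₀) : ⟪deriv X t₀, x - X t₀⟫ = 0 := by
  have hd := ((hX.differentiable t₀).hasDerivAt.const_sub x).norm_sq
  have h0 := h.hasDerivAt_eq_zero hd
  rw [inner_neg_right, real_inner_comm] at h0
  linarith

/-- Let `X t₀` be the point of the curve farthest from `X 0`. Then `X 0 - X t₀` is normal to the
curve at `t₀` and has length at most `t₀ < 1`. If `r` exceeded `1`, the point `X 0` would have two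
tube representations, one over `0` and one over `t₀`. -/
theorem tubeRadius_le_one {X n₁ n₂ : ℝ → E3} {cΓ r : ℝ} (hX : IsCenterline X)
    (hΓ : NonSelfIntersecting X cΓ) (hn : IsNormalFrame X n₁ n₂) (hr : IsTubeRadius X n₁ n₂ r) :
    r ≤ 1 := by
  obtain ⟨t₀, ht₀, hmax⟩ := exists_le_norm_sub hX (X 0)
  by_contra! hlt
  have hM : ‖X 0 - X t₀‖ < r := by
    have h1 := hX.norm_sub_le 0 t₀
    rw [zero_sub, abs_neg, abs_of_nonneg ht₀.1] at h1
    linarith [ht₀.2]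
  -- The parameter `1/2` is antipodal to `0`, so non-self-intersection makes the maximal distance at
  -- least `cΓ / 2`; hence `t₀` is not `0`.
  have hpos : 0 < ‖X 0 - X t₀‖ := by
    refine lt_of_lt_of_le ?_ (hmax (1 / 2))
    refine lt_of_lt_of_le (mul_pos hΓ.1 ?_) (hΓ.2 0 (1 / 2))
    rw [zero_sub, AddCircle.coe_neg, norm_neg]
    rw [(AddCircle.norm_coe_eq_abs_iff 1 one_ne_zero).2 (by norm_num)]
    norm_num
  have hperp := inner_deriv_eq_zero_of_isLocalExtr hX (X 0) (t₀ := t₀)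
    (Or.inr (Filter.Eventually.of_forall fun t =>
      pow_le_pow_left₀ (norm_nonneg _) (hmax t) 2))
  obtain ⟨θ, hθ⟩ := hn.exists_eq_smul_eRho t₀ hperp
  have hdist : Metric.infDist (X 0) (Set.range X) < r := by
    rw [Metric.infDist_zero_of_mem (Set.mem_range_self 0)]; exact hr.1
  have huniq := (hr.2 (X 0) hdist).unique
    ⟨⟨le_rfl, one_pos⟩, 0, 0, le_rfl, hr.1, by simp⟩
    ⟨ht₀, ‖X 0 - X t₀‖, θ, hpos.le, hM, by rw [← hθ]; abel⟩
  rw [← huniq] at hpos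
  simp at hpos

/-- The displacement from the nearest curve point is normal to the curve, so it gives a tube
representation of the surface point. By uniqueness the nearest point is `X s`, at distance exactly
`ε`. -/
theorem le_norm_surfacePoint_sub {X n₁ n₂ : ℝ → E3} {r ε : ℝ} (hX : IsCenterline X)
    (hn : IsNormalFrame X n₁ n₂) (hr : IsTubeRadius X n₁ n₂ r)
    (hε : 0 < ε) (hεr : ε < r) (s θ t : ℝ) : ε ≤ ‖surfacePoint X n₁ n₂ ε s θ - X t‖ := by
  set x := surfacePoint X n₁ n₂ ε s θ with hx
  have hxs : ‖x - X s‖ = ε := by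
    rw [hx, surfacePoint, add_sub_cancel_left, norm_smul, hn.norm_eRho, mul_one,
      Real.norm_of_nonneg hε.le]
  obtain ⟨t₀, ht₀, hmin⟩ := exists_norm_sub_le hX x
  have hM : ‖x - X t₀‖ < r := lt_of_le_of_lt ((hmin s).trans hxs.le) hεr
  have hperp := inner_deriv_eq_zero_of_isLocalExtr hX x (t₀ := t₀)
    (Or.inl (Filter.Eventually.of_forall fun t =>
      pow_le_pow_left₀ (norm_nonneg _) (hmin t) 2))
  obtain ⟨φ, hφ⟩ := hn.exists_eq_smul_eRho t₀ hperp
  have hdist : Metric.infDist x (Set.range X) < r := by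
    refine lt_of_le_of_lt (Metric.infDist_le_dist_of_mem (Set.mem_range_self t₀)) ?_
    rwa [dist_eq_norm]
  have hfract : ∀ {g : ℝ → E3}, Function.Periodic g 1 → g (Int.fract s) = g s := by
    intro g hg
    have h := hg.sub_int_mul_eq (x := s) ⌊s⌋
    rwa [mul_one] at h
  have huniq := (hr.2 x hdist).unique
    ⟨⟨Int.fract_nonneg s, Int.fract_lt_one s⟩, ε, θ, hε.le, hεr, by
      rw [hx, surfacePoint, eRho, eRho, hfract hX.periodic, hfract hn.periodic₁,
        hfract hn.periodic₂]⟩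
    ⟨ht₀, ‖x - X t₀‖, φ, norm_nonneg _, hM, by rw [← hφ]; abel⟩
  rw [← hxs, ← hX.apply_fract s, huniq]
  exact hmin t

/-- Add `ε ≤ ‖R‖` and `cΓ |s - t| ≤ ‖R‖ + ε ≤ 2 ‖R‖`. The restriction to half a period identifies
circle distance with `|s - t|`. -/
theorem add_le_norm_surfacePoint_sub {X n₁ n₂ : ℝ → E3} {cΓ r ε : ℝ} (hX : IsCenterline X)
    (hΓ : NonSelfIntersecting X cΓ) (hn : IsNormalFrame X n₁ n₂) (hr : IsTubeRadius X n₁ n₂ r)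
    (hε : 0 < ε) (hεr : ε < r) (s θ : ℝ) {t : ℝ} (ht : |s - t| ≤ 1 / 2) :
    (ε + cΓ * |s - t|) / 3 ≤ ‖surfacePoint X n₁ n₂ ε s θ - X t‖ := by
  have h1 := le_norm_surfacePoint_sub hX hn hr hε hεr s θ t
  have h2 := hΓ.2 s t
  rw [(AddCircle.norm_coe_eq_abs_iff 1 one_ne_zero).2 (by simpa using ht)] at h2
  have h3 : ‖X s - X t‖ ≤ ‖surfacePoint X n₁ n₂ ε s θ - X t‖ + ε := by
    have e : X s - X t = (surfacePoint X n₁ n₂ ε s θ - X t) - ε • eRho n₁ n₂ s θ := by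
      rw [surfacePoint]; abel
    rw [e]
    refine (_root_.norm_sub_le _ _).trans ?_
    rw [norm_smul, hn.norm_eRho, mul_one, Real.norm_of_nonneg hε.le]
  linarith

/-! ### The stress as a single integral -/

/-- The velocity at displacement `R` from a point force `g` with its doublet correction. -/
def velocityKernel (ε : ℝ) (R g : E3) : E3 := stokeslet R g + (ε ^ 2 / 2) • doublet R g

/-- The derivative of `velocityKernel ε R g` in `R`. -/
def gradKernel (ε : ℝ) (R g : E3) : E3 →L[ℝ] E3 :=
  (innerSL ℝ R).smulRight ((-(1 / ‖R‖ ^ 3) - ε ^ 2 / 2 * (3 / ‖R‖ ^ 5)) • g)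
    + (innerSL ℝ g).smulRight ((1 / ‖R‖ ^ 3 - ε ^ 2 / 2 * (3 / ‖R‖ ^ 5)) • R)
    + (⟪R, g⟫ / ‖R‖ ^ 3 - ε ^ 2 / 2 * (3 * ⟪R, g⟫ / ‖R‖ ^ 5)) • ContinuousLinearMap.id ℝ E3
    + (innerSL ℝ R).smulRight
      ((-(3 * ⟪R, g⟫ / ‖R‖ ^ 5) + ε ^ 2 / 2 * (15 * ⟪R, g⟫ / ‖R‖ ^ 7)) • R)

/-- The traction on a surface with normal `-e` at displacement `R` from a point force `g` with its
doublet correction. -/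
def tractionKernel (ε : ℝ) (R g e : E3) : E3 :=
  (3 / (4 * Real.pi)) • ((⟪R, g⟫ * ⟪R, e⟫ / ‖R‖ ^ 5) • R)
    + (ε ^ 2 / (8 * Real.pi)) • ((3 / ‖R‖ ^ 5) • (⟪R, e⟫ • g + ⟪R, g⟫ • e + ⟪e, g⟫ • R)
      - (15 * (⟪R, g⟫ * ⟪R, e⟫) / ‖R‖ ^ 7) • R)

/-! ### Derivative and continuity of the kernels -/

theorem hasFDerivAt_one_div_norm_pow (k : ℕ) {R : E3} (hR : R ≠ 0) :
    HasFDerivAt (fun R : E3 => 1 / ‖R‖ ^ k) (-((k : ℝ) / ‖R‖ ^ (k + 2)) • innerSL ℝ R) R := by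
  have hpos : 0 < ‖R‖ := norm_pos_iff.2 hR
  have h1 : HasFDerivAt (fun R : E3 => ‖R‖) ((1 / ‖R‖) • innerSL ℝ R) R := by
    have h := ((hasStrictFDerivAt_norm_sq R).hasFDerivAt).sqrt (by positivity)
    simp only [Real.sqrt_sq (norm_nonneg _)] at h
    refine h.congr_fderiv ?_
    ext v
    simp
    field_simp
  have h2 := ((hasDerivAt_pow k ‖R‖).inv (by positivity)).comp_hasFDerivAt R h1
  simp only [one_div]
  refine h2.congr_fderiv ?_
  ext v
  rcases k with _ | k
  · simp
  · simp
    field_simp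
    ring

theorem hasFDerivAt_velocityKernel (ε : ℝ) (g : E3) {R : E3} (hR : R ≠ 0) :
    HasFDerivAt (fun R => velocityKernel ε R g) (gradKernel ε R g) R := by
  have hpos : 0 < ‖R‖ := norm_pos_iff.2 hR
  have h1 := hasFDerivAt_one_div_norm_pow 1 hR
  have h3 := hasFDerivAt_one_div_norm_pow 3 hR
  have h5 := hasFDerivAt_one_div_norm_pow 5 hR
  have hin : HasFDerivAt (fun R : E3 => ⟪R, g⟫) (innerSL ℝ g) R := by
    have := (innerSL ℝ g).hasFDerivAt (x := R)
    simpa [real_inner_comm] using this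
  have hid := hasFDerivAt_id (𝕜 := ℝ) R
  have h := ((h1.smul_const g).add ((hin.mul h3).smul hid)).add
    (((h3.smul_const g).sub (((hin.const_mul 3).mul h5).smul hid)).const_smul (ε ^ 2 / 2))
  refine (h.congr_fderiv ?_).congr_of_eventuallyEq (Filter.Eventually.of_forall fun R => ?_)
  · refine ContinuousLinearMap.ext fun v => ?_
    simp [gradKernel]
    module
  · simp [velocityKernel, stokeslet, doublet, div_eq_mul_inv]

theorem continuousOn_gradKernel (ε : ℝ) :
    ContinuousOn (fun p : E3 × E3 => gradKernel ε p.1 p.2) {p | p.1 ≠ 0} := by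
  have hn : ∀ k : ℕ, ∀ p ∈ {p : E3 × E3 | p.1 ≠ 0}, ‖p.1‖ ^ k ≠ 0 := fun k p hp =>
    pow_ne_zero k (norm_ne_zero_iff.2 hp)
  have hL : ∀ (c : E3 →L[ℝ] ℝ) (v : E3),
      c.smulRight v = ContinuousLinearMap.smulRightL ℝ E3 E3 c v := fun _ _ => rfl
  simp only [gradKernel, hL]
  fun_prop (disch := first | exact hn _ | assumption)

theorem continuousOn_velocityKernel (ε : ℝ) :
    ContinuousOn (fun p : E3 × E3 => velocityKernel ε p.1 p.2) {p | p.1 ≠ 0} := by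
  have hn : ∀ k : ℕ, ∀ p ∈ {p : E3 × E3 | p.1 ≠ 0}, ‖p.1‖ ^ k ≠ 0 := fun k p hp =>
    pow_ne_zero k (norm_ne_zero_iff.2 hp)
  have hn' : ∀ p ∈ {p : E3 × E3 | p.1 ≠ 0}, ‖p.1‖ ≠ 0 := fun p hp => norm_ne_zero_iff.2 hp
  unfold velocityKernel stokeslet doublet
  fun_prop (disch := first | exact hn _ | exact hn' | assumption)

theorem continuousOn_tractionKernel (ε : ℝ) :
    ContinuousOn (fun p : E3 × E3 × E3 => tractionKernel ε p.1 p.2.1 p.2.2) {p | p.1 ≠ 0} := by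
  have hn : ∀ k : ℕ, ∀ p ∈ {p : E3 × E3 × E3 | p.1 ≠ 0}, ‖p.1‖ ^ k ≠ 0 := fun k p hp =>
    pow_ne_zero k (norm_ne_zero_iff.2 hp)
  unfold tractionKernel
  fun_prop (disch := first | exact hn _ | assumption)

/-! ### Differentiation under the integral sign -/

section Integral

variable {X f : ℝ → E3} {ε δ : ℝ} {x : E3}

/-- On the closed ball of radius `δ/2` around `x` the distance to the curve stays positive, so the
gradient kernel is continuous on a compact product and bounded by a constant, which serves as the
dominating function. -/
theorem hasFDerivAt_velocitySB (ε : ℝ) (hX : Continuous X) (hf : Continuous f) (hδ : 0 < δ)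
    (hx : ∀ t, δ ≤ ‖x - X t‖) :
    HasFDerivAt (velocitySB X f ε)
      ((1 / (8 * Real.pi)) • ∫ t in (0 : ℝ)..1, gradKernel ε (x - X t) (f t)) x := by
  have hne : ∀ y ∈ Metric.closedBall x (δ / 2), ∀ t, y - X t ≠ 0 := by
    intro y hy t h0
    rw [Metric.mem_closedBall, dist_comm, dist_eq_norm] at hy
    have h := hx t
    rw [← sub_eq_zero.1 h0] at h
    linarith
  have hxx : x ∈ Metric.closedBall x (δ / 2) := Metric.mem_closedBall_self (by linarith)
  have hcont : ContinuousOn (fun p : E3 × ℝ => gradKernel ε (p.1 - X p.2) (f p.2))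
      (Metric.closedBall x (δ / 2) ×ˢ Set.Icc 0 1) := by
    refine (continuousOn_gradKernel ε).comp (f := fun p : E3 × ℝ => (p.1 - X p.2, f p.2))
      (by fun_prop) fun p hp => hne p.1 hp.1 p.2
  obtain ⟨C, hC⟩ := ((isCompact_closedBall x (δ / 2)).prod isCompact_Icc).exists_bound_of_continuousOn
    hcont
  have hF : ∀ y ∈ Metric.closedBall x (δ / 2),
      Continuous fun t => velocityKernel ε (y - X t) (f t) := fun y hy =>
    (continuousOn_velocityKernel ε).comp_continuous (f := fun t => (y - X t, f t))
      (by fun_prop) fun t => hne y hy t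
  have hF' : Continuous fun t => gradKernel ε (x - X t) (f t) :=
    (continuousOn_gradKernel ε).comp_continuous (f := fun t => (x - X t, f t))
      (by fun_prop) fun t => hne x hxx t
  have hball : Metric.closedBall x (δ / 2) ∈ nhds x := Metric.closedBall_mem_nhds x (by linarith)
  have key : HasFDerivAt (fun y => ∫ t in (0 : ℝ)..1, velocityKernel ε (y - X t) (f t))
      (∫ t in (0 : ℝ)..1, gradKernel ε (x - X t) (f t)) x := by
    refine intervalIntegral.hasFDerivAt_integral_of_dominated_of_fderiv_le
      (F := fun y t => velocityKernel ε (y - X t) (f t))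
      (F' := fun y t => gradKernel ε (y - X t) (f t)) (bound := fun _ => C) hball ?_
      ((hF x hxx).intervalIntegrable _ _) hF'.aestronglyMeasurable ?_
      intervalIntegrable_const ?_
    · filter_upwards [hball] with y hy using (hF y hy).aestronglyMeasurable
    · refine Filter.Eventually.of_forall fun t ht y hy => hC (y, t) ⟨hy, ?_⟩
      rw [Set.uIoc_of_le zero_le_one] at ht
      exact ⟨ht.1.le, ht.2⟩
    · refine Filter.Eventually.of_forall fun t _ y hy => ?_
      have h := (hasFDerivAt_velocityKernel ε (f t) (hne y hy t)).comp y
        ((hasFDerivAt_id (𝕜 := ℝ) y).sub_const (X t))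
      simpa [Function.comp_def] using h
  exact key.const_smul (1 / (8 * Real.pi))

theorem adjoint_intervalIntegral_apply {G : ℝ → E3 →L[ℝ] E3} (hG : Continuous G) (a b : ℝ)
    (v : E3) : ContinuousLinearMap.adjoint (∫ t in a..b, G t) v =
      ∫ t in a..b, ContinuousLinearMap.adjoint (G t) v := by
  have hGv : ∀ w, Continuous fun t => G t w := fun w => by fun_prop
  have hGa : Continuous fun t => ContinuousLinearMap.adjoint (G t) v :=
    ((ContinuousLinearMap.adjoint (𝕜 := ℝ) (E := E3) (F := E3)).continuous.comp hG).clm_apply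
      continuous_const
  refine ext_inner_left ℝ fun w => ?_
  rw [ContinuousLinearMap.adjoint_inner_right,
    ContinuousLinearMap.intervalIntegral_apply (μ := MeasureTheory.volume)
      (hG.intervalIntegrable a b)]
  have h1 := (innerSL ℝ v).intervalIntegral_comp_comm (μ := MeasureTheory.volume)
    ((hGv w).intervalIntegrable a b)
  have h2 := (innerSL ℝ w).intervalIntegral_comp_comm (μ := MeasureTheory.volume)
    (hGa.intervalIntegrable a b)
  simp only [innerSL_apply_apply] at h1 h2
  rw [real_inner_comm, ← h1, ← h2]
  refine intervalIntegral.integral_congr fun t _ => ?_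
  simp only [ContinuousLinearMap.adjoint_inner_right]
  rw [real_inner_comm]

theorem adjoint_gradKernel_apply (ε : ℝ) (R g v : E3) :
    ContinuousLinearMap.adjoint (gradKernel ε R g) v =
      ((-(1 / ‖R‖ ^ 3) - ε ^ 2 / 2 * (3 / ‖R‖ ^ 5)) * ⟪g, v⟫) • R
        + ((1 / ‖R‖ ^ 3 - ε ^ 2 / 2 * (3 / ‖R‖ ^ 5)) * ⟪R, v⟫) • g
        + (⟪R, g⟫ / ‖R‖ ^ 3 - ε ^ 2 / 2 * (3 * ⟪R, g⟫ / ‖R‖ ^ 5)) • v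
        + ((-(3 * ⟪R, g⟫ / ‖R‖ ^ 5) + ε ^ 2 / 2 * (15 * ⟪R, g⟫ / ‖R‖ ^ 7)) * ⟪R, v⟫) • R := by
  refine ext_inner_left ℝ fun w => ?_
  rw [ContinuousLinearMap.adjoint_inner_right]
  simp only [gradKernel, add_apply,
    ContinuousLinearMap.smulRight_apply, innerSL_apply_apply, smul_apply,
    ContinuousLinearMap.id_apply, inner_add_left, inner_add_right, inner_smul_left,
    inner_smul_right, real_inner_comm w, RCLike.conj_to_real]
  ring

/-- In the Stokeslet part the pressure cancels the isotropic term of the gradient, and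
symmetrization cancels the `g / ‖R‖³` terms, leaving only the triple product `⟪R, g⟫ ⟪R, e⟫ R /
‖R‖⁵`. The doublet carries no pressure. -/
theorem stress_apply_neg (ε : ℝ) (hX : Continuous X) (hf : Continuous f) (hδ : 0 < δ)
    (hx : ∀ t, δ ≤ ‖x - X t‖) (e : E3) :
    stress (velocitySB X f ε) (pressureSB X f) x (-e) =
      ∫ t in (0 : ℝ)..1, tractionKernel ε (x - X t) (f t) e := by
  have hne : ∀ t, x - X t ≠ 0 := fun t => norm_pos_iff.1 (hδ.trans_le (hx t))
  have hG : Continuous fun t => gradKernel ε (x - X t) (f t) :=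
    (continuousOn_gradKernel ε).comp_continuous (f := fun t => (x - X t, f t))
      (by fun_prop) hne
  have hGv : Continuous fun t => gradKernel ε (x - X t) (f t) e := by fun_prop
  have hGa : Continuous fun t => ContinuousLinearMap.adjoint (gradKernel ε (x - X t) (f t)) e :=
    ((ContinuousLinearMap.adjoint (𝕜 := ℝ) (E := E3) (F := E3)).continuous.comp hG).clm_apply
      continuous_const
  have hP : Continuous fun t => ⟪x - X t, f t⟫ / ‖x - X t‖ ^ 3 := by
    have : ∀ t, ‖x - X t‖ ^ 3 ≠ 0 := fun t => pow_ne_zero 3 (norm_ne_zero_iff.2 (hne t))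
    fun_prop (disch := assumption)
  have hadj : ∀ (c : ℝ) (A : E3 →L[ℝ] E3), ContinuousLinearMap.adjoint (c • A) =
      c • ContinuousLinearMap.adjoint A := fun c A => by simp
  rw [stress, strainRate, (hasFDerivAt_velocitySB ε hX hf hδ hx).fderiv, hadj]
  simp only [add_apply, smul_apply, map_neg,
    ContinuousLinearMap.id_apply]
  rw [adjoint_intervalIntegral_apply hG,
    ContinuousLinearMap.intervalIntegral_apply (μ := MeasureTheory.volume)
      (hG.intervalIntegrable 0 1), pressureSB]
  -- Here `c = 1/(4π)` is the pressure prefactor; the velocity prefactor is `c/2`.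
  have e1 : ∀ (p c : ℝ) (v w : E3),
      -(-(c * p) • e + (2 : ℝ) • (1 / 2 : ℝ) • ((c / 2) • v + (c / 2) • w)) =
        c • (p • e) - (c / 2) • (v + w) := by intros; module
  have e2 : 1 / (8 * Real.pi) = 1 / (4 * Real.pi) / 2 := by ring
  rw [e2, e1, ← intervalIntegral.integral_smul_const, ← intervalIntegral.integral_add
    (hGv.intervalIntegrable 0 1) (hGa.intervalIntegrable 0 1), ← intervalIntegral.integral_smul,
    ← intervalIntegral.integral_smul, ← intervalIntegral.integral_sub]
  · refine intervalIntegral.integral_congr fun t _ => ?_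
    have hp : ‖x - X t‖ ≠ 0 := norm_ne_zero_iff.2 (hne t)
    simp only [adjoint_gradKernel_apply]
    simp only [tractionKernel, gradKernel, add_apply,
      ContinuousLinearMap.smulRight_apply, innerSL_apply_apply, smul_apply,
      ContinuousLinearMap.id_apply, real_inner_comm (f t) e]
    have : Real.pi ≠ 0 := Real.pi_ne_zero
    match_scalars <;> field_simp <;> ring
  · exact Continuous.intervalIntegrable (by fun_prop) 0 1
  · exact Continuous.intervalIntegrable (by fun_prop) 0 1

end Integral

/-! ### Pointwise comparison with the straight filament -/

/-- The angular part of the Stokeslet traction. -/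
def dyad (u g : E3) : E3 := ⟪u, g⟫ • u

/-- The angular part of the doublet traction. -/
def doubletAngular (u e g : E3) : E3 :=
  (3 : ℝ) • (⟪u, e⟫ • g + ⟪u, g⟫ • e + ⟪e, g⟫ • u) - (15 * (⟪u, g⟫ * ⟪u, e⟫)) • u

/-- Separates powers of the distance from bounded angular factors. The Stokeslet factor `⟪R, e⟫`
stays unnormalized because it equals `ε + ⟪e, V⟫` exactly on the surface, so it need not be
approximated. -/
theorem tractionKernel_eq (ε : ℝ) {R : E3} (hR : R ≠ 0) (g e : E3) :
    tractionKernel ε R g e = (3 / (4 * Real.pi)) • (⟪R, e⟫ • (‖R‖⁻¹ ^ 3 • dyad (‖R‖⁻¹ • R) g))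
      + (ε ^ 2 / (8 * Real.pi)) • (‖R‖⁻¹ ^ 4 • doubletAngular (‖R‖⁻¹ • R) e g) := by
  have hp : ‖R‖ ≠ 0 := norm_ne_zero_iff.2 hR
  simp only [tractionKernel, dyad, doubletAngular, real_inner_smul_left]
  match_scalars <;> field_simp

theorem dyad_sub_right (u g h : E3) : dyad u (g - h) = dyad u g - dyad u h := by
  simp only [dyad, inner_sub_right]; module

theorem doubletAngular_sub_right (u e g h : E3) :
    doubletAngular u e (g - h) = doubletAngular u e g - doubletAngular u e h := by
  simp only [doubletAngular, inner_sub_right]; module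

theorem abs_inner_le_of_norm_le_one {u : E3} (hu : ‖u‖ ≤ 1) (g : E3) : |⟪u, g⟫| ≤ ‖g‖ :=
  (abs_real_inner_le_norm u g).trans (mul_le_of_le_one_left (norm_nonneg g) hu)

theorem norm_dyad_le {u : E3} (hu : ‖u‖ ≤ 1) (g : E3) : ‖dyad u g‖ ≤ ‖g‖ := by
  rw [dyad, norm_smul, Real.norm_eq_abs]
  exact (mul_le_of_le_one_right (abs_nonneg _) hu).trans (abs_inner_le_of_norm_le_one hu g)

theorem norm_dyad_sub_le {u v : E3} (hu : ‖u‖ ≤ 1) (hv : ‖v‖ ≤ 1) (g : E3) :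
    ‖dyad u g - dyad v g‖ ≤ 2 * ‖u - v‖ * ‖g‖ := by
  have e : dyad u g - dyad v g = ⟪u - v, g⟫ • u + ⟪v, g⟫ • (u - v) := by
    simp only [dyad, inner_sub_left]; module
  rw [e]
  refine (norm_add_le _ _).trans ?_
  rw [norm_smul, norm_smul, Real.norm_eq_abs, Real.norm_eq_abs]
  have h1 := abs_real_inner_le_norm (u - v) g
  have h2 := abs_inner_le_of_norm_le_one hv g
  have h3 : |⟪u - v, g⟫| * ‖u‖ ≤ ‖u - v‖ * ‖g‖ :=
    (mul_le_of_le_one_right (abs_nonneg _) hu).trans h1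
  have h4 : |⟪v, g⟫| * ‖u - v‖ ≤ ‖g‖ * ‖u - v‖ := by gcongr
  linarith

theorem norm_doubletAngular_le {u e : E3} (hu : ‖u‖ ≤ 1) (he : ‖e‖ ≤ 1) (g : E3) :
    ‖doubletAngular u e g‖ ≤ 24 * ‖g‖ := by
  have hue : |⟪u, e⟫| ≤ 1 := (abs_inner_le_of_norm_le_one hu e).trans he
  have hug := abs_inner_le_of_norm_le_one hu g
  have heg := abs_inner_le_of_norm_le_one he g
  have h1 : |⟪u, e⟫| * ‖g‖ ≤ ‖g‖ := mul_le_of_le_one_left (norm_nonneg g) hue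
  have h2 : |⟪u, g⟫| * ‖e‖ ≤ ‖g‖ := (mul_le_of_le_one_right (abs_nonneg _) he).trans hug
  have h3 : |⟪e, g⟫| * ‖u‖ ≤ ‖g‖ := (mul_le_of_le_one_right (abs_nonneg _) hu).trans heg
  have h4 : |⟪u, g⟫| * |⟪u, e⟫| * ‖u‖ ≤ ‖g‖ :=
    (mul_le_of_le_one_right (by positivity) hu).trans
      ((mul_le_of_le_one_right (abs_nonneg _) hue).trans hug)
  calc ‖doubletAngular u e g‖
      ≤ 3 * (‖⟪u, e⟫ • g‖ + ‖⟪u, g⟫ • e‖ + ‖⟪e, g⟫ • u‖)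
        + 15 * (|⟪u, g⟫| * |⟪u, e⟫| * ‖u‖) := by
        refine (norm_sub_le _ _).trans (add_le_add ?_ (le_of_eq ?_))
        · rw [norm_smul, Real.norm_of_nonneg (by norm_num)]
          gcongr
          exact norm_add₃_le
        · rw [norm_smul, Real.norm_eq_abs, abs_mul, abs_mul, abs_of_pos (by norm_num : (0:ℝ) < 15)]
          ring
    _ ≤ 24 * ‖g‖ := by
        simp only [norm_smul, Real.norm_eq_abs]
        linarith

/-- Telescoping in `u - v`: three terms with weight `3`, and with weight `15` a direct term plus a
dyad difference of Lipschitz constant `2`, whence `54 = 9 + 45`. -/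
theorem norm_doubletAngular_sub_le {u v e : E3} (hu : ‖u‖ ≤ 1) (hv : ‖v‖ ≤ 1) (he : ‖e‖ ≤ 1)
    (g : E3) : ‖doubletAngular u e g - doubletAngular v e g‖ ≤ 54 * ‖u - v‖ * ‖g‖ := by
  have e1 : doubletAngular u e g - doubletAngular v e g =
      (3 : ℝ) • (⟪u - v, e⟫ • g + ⟪u - v, g⟫ • e + ⟪e, g⟫ • (u - v))
        - (15 : ℝ) • (⟪u - v, e⟫ • dyad u g + ⟪v, e⟫ • (dyad u g - dyad v g)) := by
    simp only [doubletAngular, dyad, inner_sub_left]; module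
  have hue : |⟪u - v, e⟫| ≤ ‖u - v‖ :=
    (abs_real_inner_le_norm _ _).trans (mul_le_of_le_one_right (norm_nonneg _) he)
  have hve : |⟪v, e⟫| ≤ 1 := (abs_inner_le_of_norm_le_one hv e).trans he
  have h1 : ‖⟪u - v, e⟫ • g‖ ≤ ‖u - v‖ * ‖g‖ := by
    rw [norm_smul, Real.norm_eq_abs]; gcongr
  have h2 : ‖⟪u - v, g⟫ • e‖ ≤ ‖u - v‖ * ‖g‖ := by
    rw [norm_smul, Real.norm_eq_abs]
    exact (mul_le_of_le_one_right (abs_nonneg _) he).trans (abs_real_inner_le_norm _ _)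
  have h3 : ‖⟪e, g⟫ • (u - v)‖ ≤ ‖u - v‖ * ‖g‖ := by
    rw [norm_smul, Real.norm_eq_abs, mul_comm]
    gcongr
    exact abs_inner_le_of_norm_le_one he g
  have h4 : ‖⟪u - v, e⟫ • dyad u g‖ ≤ ‖u - v‖ * ‖g‖ := by
    rw [norm_smul, Real.norm_eq_abs]
    gcongr
    exact norm_dyad_le hu g
  have h5 : ‖⟪v, e⟫ • (dyad u g - dyad v g)‖ ≤ 2 * ‖u - v‖ * ‖g‖ := by
    rw [norm_smul, Real.norm_eq_abs]
    exact (mul_le_of_le_one_left (norm_nonneg _) hve).trans (norm_dyad_sub_le hu hv g)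
  rw [e1]
  refine (norm_sub_le _ _).trans ?_
  rw [norm_smul, norm_smul, Real.norm_of_nonneg (by norm_num : (0:ℝ) ≤ 3),
    Real.norm_of_nonneg (by norm_num : (0:ℝ) ≤ 15)]
  have h6 := norm_add₃_le (a := ⟪u - v, e⟫ • g) (b := ⟪u - v, g⟫ • e) (c := ⟪e, g⟫ • (u - v))
  have h7 := norm_add_le (⟪u - v, e⟫ • dyad u g) (⟪v, e⟫ • (dyad u g - dyad v g))
  linarith

theorem norm_smul_sub_smul_le {a b : ℝ} (hb : 0 ≤ b) (p q : E3) :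
    ‖a • p - b • q‖ ≤ |a - b| * ‖p‖ + b * ‖p - q‖ := by
  have e : a • p - b • q = (a - b) • p + b • (p - q) := by module
  rw [e]
  refine (norm_add_le _ _).trans (le_of_eq ?_)
  rw [norm_smul, norm_smul, Real.norm_eq_abs, Real.norm_of_nonneg hb]

theorem abs_pow_three_sub_le {a b M d : ℝ} (ha : 0 ≤ a) (hb : 0 ≤ b) (haM : a ≤ M) (hbM : b ≤ M)
    (hd : |a - b| ≤ d) : |a ^ 3 - b ^ 3| ≤ 3 * d * M ^ 2 := by
  have e : a ^ 3 - b ^ 3 = (a - b) * (a ^ 2 + a * b + b ^ 2) := by ring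
  have hM : 0 ≤ M := ha.trans haM
  have hd0 : 0 ≤ d := (abs_nonneg _).trans hd
  rw [e, abs_mul, abs_of_nonneg (by positivity : 0 ≤ a ^ 2 + a * b + b ^ 2)]
  calc |a - b| * (a ^ 2 + a * b + b ^ 2) ≤ d * (M ^ 2 + M * M + M ^ 2) := by gcongr
    _ = 3 * d * M ^ 2 := by ring

theorem abs_pow_four_sub_le {a b M d : ℝ} (ha : 0 ≤ a) (hb : 0 ≤ b) (haM : a ≤ M) (hbM : b ≤ M)
    (hd : |a - b| ≤ d) : |a ^ 4 - b ^ 4| ≤ 4 * d * M ^ 3 := by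
  have e : a ^ 4 - b ^ 4 = (a - b) * (a ^ 3 + a ^ 2 * b + a * b ^ 2 + b ^ 3) := by ring
  have hM : 0 ≤ M := ha.trans haM
  have hd0 : 0 ≤ d := (abs_nonneg _).trans hd
  rw [e, abs_mul, abs_of_nonneg (by positivity : 0 ≤ a ^ 3 + a ^ 2 * b + a * b ^ 2 + b ^ 3)]
  calc |a - b| * (a ^ 3 + a ^ 2 * b + a * b ^ 2 + b ^ 3)
      ≤ d * (M ^ 3 + M ^ 2 * M + M * M ^ 2 + M ^ 3) := by gcongr
    _ = 4 * d * M ^ 3 := by ring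

/-- The part of the traction of a straight filament that is even in `e`, with `b` the inverse
distance. -/
def straightKernel (ε τ b : ℝ) (T e g : E3) : E3 :=
  (3 / (4 * Real.pi)) • ((ε * b ^ 5) • (ε ^ 2 • dyad e g + τ ^ 2 • dyad T g))
    + (ε ^ 2 / (8 * Real.pi)) • ((3 * ε * b ^ 5) • (g + (2 : ℝ) • dyad e g)
      - (15 * ε * b ^ 7) • (ε ^ 2 • dyad e g + τ ^ 2 • dyad T g))

/-- A part of the traction that is odd in `e`, with `b` the inverse distance on the straight
filament and `V` the displacement along the centerline. -/
def oddKernel (ε τ b : ℝ) (V T e g : E3) : E3 :=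
  (3 / (4 * Real.pi)) • (b ^ 5 • (⟪e, V⟫ • (ε ^ 2 • dyad e g + τ ^ 2 • dyad T g)
      + (ε ^ 2 * τ) • (⟪e, g⟫ • T + ⟪T, g⟫ • e)))
    + (ε ^ 2 / (8 * Real.pi)) • ((3 * τ * b ^ 5) • (⟪T, g⟫ • e + ⟪e, g⟫ • T)
      - (15 * ε ^ 2 * τ * b ^ 7) • (⟪e, g⟫ • T + ⟪T, g⟫ • e))

theorem dyad_neg (e g : E3) : dyad (-e) g = dyad e g := by simp [dyad]

theorem oddKernel_neg (ε τ b : ℝ) (V T e g : E3) :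
    oddKernel ε τ b V T (-e) g = -oddKernel ε τ b V T e g := by
  simp only [oddKernel, dyad_neg, inner_neg_left]; module

/-- Since `⟪T, e⟫ = 0`, expanding the dyad and the doublet sorts terms by parity in `e`. The factor
`⟪e, V⟫` is odd, so it makes `⟪e, V⟫` times the mixed `T`, `e` dyad even; this last summand is small
and is estimated directly. -/
theorem straight_decomposition (ε τ b : ℝ) (V : E3) {T e : E3} (hTe : ⟪T, e⟫ = 0) (he : ‖e‖ = 1)
    (g : E3) :
    (3 / (4 * Real.pi)) • ((ε + ⟪e, V⟫) • (b ^ 3 • dyad (b • (τ • T + ε • e)) g))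
      + (ε ^ 2 / (8 * Real.pi)) • (b ^ 4 • doubletAngular (b • (τ • T + ε • e)) e g) =
    straightKernel ε τ b T e g + oddKernel ε τ b V T e g
      + (3 / (4 * Real.pi) * ⟪e, V⟫ * b ^ 5 * ε * τ) • (⟪e, g⟫ • T + ⟪T, g⟫ • e) := by
  have hee : ⟪e, e⟫ = 1 := by rw [real_inner_self_eq_norm_sq, he, one_pow]
  simp only [straightKernel, oddKernel, doubletAngular, dyad, inner_add_left,
    real_inner_smul_left, hTe, hee]
  module

/-! ### Size of the traction kernel and its distance to the straight one -/

section Estimate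

variable {ε τ κ A N ρ : ℝ} {V T e g h : E3}

/-- Crude `1/ρ²` bound, sufficient where the Jacobian correction already supplies a factor `ε²`. -/
theorem norm_tractionKernel_le (hε : 0 < ε) {R : E3} (hεR : ε ≤ ‖R‖) (hρ : 0 < ρ)
    (hA : ρ ≤ A * ‖R‖) (he : ‖e‖ = 1) (hh : ‖h‖ ≤ N) :
    ‖tractionKernel ε R h e‖ ≤ 2 * N * A ^ 2 * ρ⁻¹ ^ 2 := by
  have hR : 0 < ‖R‖ := hε.trans_le hεR
  have hu : ‖‖R‖⁻¹ • R‖ ≤ 1 := by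
    rw [norm_smul, norm_inv, norm_norm, inv_mul_cancel₀ hR.ne']
  have hN : 0 ≤ N := (norm_nonneg h).trans hh
  set a := ‖R‖⁻¹ with ha
  have ha0 : 0 < a := inv_pos.2 hR
  have haR : a * ‖R‖ = 1 := inv_mul_cancel₀ hR.ne'
  have haε : ε * a ≤ 1 := by rw [← haR, mul_comm a]; gcongr
  have hab : a ≤ A * ρ⁻¹ := by
    rw [ha, ← div_eq_mul_inv, le_div_iff₀ hρ, inv_mul_le_iff₀ hR, mul_comm]; exact hA
  have hpi := Real.pi_gt_three
  have h1 : ‖(3 / (4 * Real.pi)) • (⟪R, e⟫ • (a ^ 3 • dyad (a • R) h))‖ ≤ N * a ^ 2 := by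
    rw [norm_smul, norm_smul, norm_smul, Real.norm_of_nonneg (by positivity),
      Real.norm_eq_abs, Real.norm_of_nonneg (by positivity)]
    have i1 : |⟪R, e⟫| ≤ ‖R‖ := by simpa [he] using abs_real_inner_le_norm R e
    have i2 : 3 / (4 * Real.pi) ≤ 1 := by rw [div_le_one (by positivity)]; linarith
    have i3 : ‖dyad (a • R) h‖ ≤ N := (norm_dyad_le hu h).trans hh
    calc 3 / (4 * Real.pi) * (|⟪R, e⟫| * (a ^ 3 * ‖dyad (a • R) h‖))
        ≤ 1 * (‖R‖ * (a ^ 3 * N)) := by gcongr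
      _ = N * a ^ 2 * (a * ‖R‖) := by ring
      _ = N * a ^ 2 := by rw [haR, mul_one]
  have h2 : ‖(ε ^ 2 / (8 * Real.pi)) • (a ^ 4 • doubletAngular (a • R) e h)‖ ≤ N * a ^ 2 := by
    rw [norm_smul, norm_smul, Real.norm_of_nonneg (by positivity),
      Real.norm_of_nonneg (by positivity)]
    have i2 : 24 / (8 * Real.pi) ≤ 1 := by rw [div_le_one (by positivity)]; linarith
    have i3 : ‖doubletAngular (a • R) e h‖ ≤ 24 * N :=
      (norm_doubletAngular_le hu he.le h).trans (by gcongr)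
    calc ε ^ 2 / (8 * Real.pi) * (a ^ 4 * ‖doubletAngular (a • R) e h‖)
        ≤ ε ^ 2 / (8 * Real.pi) * (a ^ 4 * (24 * N)) := by gcongr
      _ = (24 / (8 * Real.pi)) * (ε * a) ^ 2 * (N * a ^ 2) := by ring
      _ ≤ 1 * 1 ^ 2 * (N * a ^ 2) := by gcongr
      _ = N * a ^ 2 := by ring
  rw [tractionKernel_eq ε (norm_pos_iff.1 hR)]
  calc _ ≤ N * a ^ 2 + N * a ^ 2 := (norm_add_le _ _).trans (add_le_add h1 h2)
    _ = 2 * N * a ^ 2 := by ring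
    _ ≤ 2 * N * (A * ρ⁻¹) ^ 2 := by gcongr
    _ = _ := by ring

/-- The constant in the pointwise comparison of the traction kernels. -/
def kernelConst (κ A : ℝ) : ℝ :=
  ((3 * κ * A ^ 3 + 1 + 4 * κ) + (96 * κ * A ^ 4 + 24 + 108 * κ)) * (1 + κ) + 2 * κ

theorem bound_sum_le {S D q : ℝ} (hκ : 0 ≤ κ) (hN : 0 ≤ N) (hS : 0 ≤ S) (hD : 0 ≤ D)
    (hq : 0 ≤ q) : N * S * (q + κ) + N * D * q + 2 * κ * N * q ≤
      ((S + D) * (1 + κ) + 2 * κ) * N * (q + 1) := by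
  have h : 0 ≤ N * (S + D * (1 + κ) + S * κ * q + D * κ * q + 2 * κ) := by positivity
  linarith

-- The displacements differ by `κ τ² ≤ κ ρ²`, so inverse distances differ by `O(κ)` and unit
-- directions by `O(κ ρ)`, while `h` differs from `g` by `N |τ|`. Each change gains one power of
-- `ρ`. The factor `ε + ⟪e, V⟫` is common to both Stokeslet terms, so its part of size `κ τ²` meets
-- only the difference, of size `1/ρ²`, and contributes a bounded error.
set_option maxHeartbeats 1000000 in
theorem norm_tractionKernel_sub_le (hε : 0 < ε) (hκ : 0 ≤ κ) (hA1 : 1 ≤ A) (hρ : 0 < ρ)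
    (hρ2 : ρ ^ 2 = ε ^ 2 + τ ^ 2) (hV : ‖V - τ • T‖ ≤ κ * τ ^ 2)
    (hA : ρ ≤ A * ‖V + ε • e‖) (hT : ‖T‖ = 1) (he : ‖e‖ = 1) (hTe : ⟪T, e⟫ = 0)
    (hg : ‖g‖ ≤ N) (hh : ‖h‖ ≤ N) (hhg : ‖h - g‖ ≤ N * |τ|) :
    ‖tractionKernel ε (V + ε • e) h e - straightKernel ε τ ρ⁻¹ T e g
      - oddKernel ε τ ρ⁻¹ V T e g‖ ≤ kernelConst κ A * N * (ε * ρ⁻¹ ^ 2 + 1) := by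
  have hN : 0 ≤ N := (norm_nonneg h).trans hh
  have hpi := Real.pi_gt_three
  set R := V + ε • e with hRdef
  set R₀ := τ • T + ε • e with hR₀def
  set b := ρ⁻¹ with hb
  set a := ‖R‖⁻¹ with ha
  set m := ⟪e, V⟫ with hm
  have hR : 0 < ‖R‖ := by
    by_contra! hle
    have : A * ‖R‖ ≤ 0 := mul_nonpos_of_nonneg_of_nonpos (by linarith) hle
    linarith
  have hb0 : 0 < b := inv_pos.2 hρ
  have ha0 : 0 < a := inv_pos.2 hR
  have hbρ : b * ρ = 1 := inv_mul_cancel₀ hρ.ne'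
  have haR : a * ‖R‖ = 1 := inv_mul_cancel₀ hR.ne'
  have hτρ : |τ| ≤ ρ := abs_le_of_sq_le_sq (by nlinarith [sq_nonneg ε]) hρ.le
  have hερ : ε ≤ ρ := by nlinarith [sq_nonneg τ]
  have hτb : |τ| * b ≤ 1 := by rw [← hbρ, mul_comm b]; gcongr
  have hεb : ε * b ≤ 1 := by rw [← hbρ, mul_comm b]; gcongr
  have hτb2 : τ ^ 2 * b ^ 2 ≤ 1 := by
    have : τ ^ 2 * b ^ 2 = (|τ| * b) ^ 2 := by rw [mul_pow, sq_abs]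
    rw [this]; exact pow_le_one₀ (by positivity) hτb
  have hR₀ : ‖R₀‖ = ρ := by
    have : ‖R₀‖ ^ 2 = ρ ^ 2 := by
      rw [hR₀def, norm_add_sq_real, norm_smul, norm_smul, real_inner_smul_left,
        real_inner_smul_right, hTe, hT, he, hρ2, Real.norm_eq_abs, Real.norm_eq_abs,
        mul_one, mul_one, sq_abs, sq_abs]
      ring
    exact (sq_eq_sq₀ (norm_nonneg _) hρ.le).1 this
  have hdR : ‖R - R₀‖ ≤ κ * τ ^ 2 := by
    have : R - R₀ = V - τ • T := by rw [hRdef, hR₀def]; abel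
    rwa [this]
  have hdR' : ‖R - R₀‖ ≤ κ * ρ ^ 2 := hdR.trans (by rw [hρ2]; gcongr; nlinarith [sq_nonneg ε])
  have hdn : |‖R‖ - ρ| ≤ κ * ρ ^ 2 := by
    rw [← hR₀]; refine (abs_norm_sub_norm_le _ _).trans ?_; rw [hR₀]; exact hdR'
  have hab : a ≤ A * b := by
    rw [ha, hb, ← div_eq_mul_inv, le_div_iff₀ hρ, inv_mul_le_iff₀ hR, mul_comm]; exact hA
  have hbb : b ≤ A * b := le_mul_of_one_le_left hb0.le hA1
  -- From `a - b = a b (ρ - ‖R‖)`: the `ρ²` in the difference of distances absorbs both inverse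
  -- distances.
  have hd : |a - b| ≤ κ * A := by
    have e1 : a - b = a * b * (ρ - ‖R‖) := by
      linear_combination (-a) * hbρ + b * haR
    rw [e1, abs_mul, abs_of_nonneg (by positivity : 0 ≤ a * b), abs_sub_comm]
    calc a * b * |‖R‖ - ρ| ≤ (A * b) * b * (κ * ρ ^ 2) := by gcongr
      _ = κ * A * (b * ρ) ^ 2 := by ring
      _ = κ * A := by rw [hbρ]; ring
  set u := a • R with hu
  set v := b • R₀ with hv
  have hu1 : ‖u‖ ≤ 1 := by rw [hu, norm_smul, Real.norm_of_nonneg ha0.le, haR]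
  have hv1 : ‖v‖ ≤ 1 := by rw [hv, norm_smul, Real.norm_of_nonneg hb0.le, hR₀, hbρ]
  have huv : ‖u - v‖ ≤ 2 * κ * ρ := by
    have e1 : u - v = b • (R - R₀) + (b * (ρ - ‖R‖)) • u := by
      have e2 : b * (ρ - ‖R‖) * a = a - b := by linear_combination a * hbρ - b * haR
      rw [hu, hv, smul_smul, e2]; module
    rw [e1]
    refine (norm_add_le _ _).trans ?_
    rw [norm_smul, norm_smul, Real.norm_of_nonneg hb0.le, norm_mul, Real.norm_of_nonneg hb0.le,
      Real.norm_eq_abs, abs_sub_comm]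
    calc b * ‖R - R₀‖ + b * |‖R‖ - ρ| * ‖u‖ ≤ b * (κ * ρ ^ 2) + b * (κ * ρ ^ 2) * 1 := by gcongr
      _ = 2 * κ * ρ * (b * ρ) := by ring
      _ = 2 * κ * ρ := by rw [hbρ, mul_one]
  have hmle : |m| ≤ κ * τ ^ 2 := by
    have e1 : m = ⟪e, V - τ • T⟫ := by
      rw [inner_sub_right, real_inner_smul_right, real_inner_comm T e, hTe]; ring
    rw [e1]
    exact (abs_inner_le_of_norm_le_one he.le _).trans hV
  -- As `T` is orthogonal to `e`, the number `m` sees only the quadratic deviation of the curve from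
  -- its tangent.
  have hRe : ⟪R, e⟫ = ε + m := by
    rw [hRdef, inner_add_left, real_inner_smul_left, real_inner_self_eq_norm_sq, he, hm,
      real_inner_comm V e]; ring
  have hSt : ‖a ^ 3 • dyad u h - b ^ 3 • dyad v g‖ ≤ N * b ^ 2 * (3 * κ * A ^ 3 + 1 + 4 * κ) := by
    refine (norm_smul_sub_smul_le (by positivity) _ _).trans ?_
    have i1 := abs_pow_three_sub_le ha0.le hb0.le hab hbb hd
    have i2 : ‖dyad u h‖ ≤ N := (norm_dyad_le hu1 h).trans hh
    have i3 : ‖dyad u h - dyad v g‖ ≤ N * ρ + 2 * (2 * κ * ρ) * N := by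
      have e1 : dyad u h - dyad v g = dyad u (h - g) + (dyad u g - dyad v g) := by
        rw [dyad_sub_right]; abel
      rw [e1]
      refine (norm_add_le _ _).trans (add_le_add ?_ ?_)
      · exact (norm_dyad_le hu1 _).trans (hhg.trans (by gcongr))
      · exact (norm_dyad_sub_le hu1 hv1 g).trans (by gcongr)
    calc _ ≤ 3 * (κ * A) * (A * b) ^ 2 * N + b ^ 3 * (N * ρ + 2 * (2 * κ * ρ) * N) := by gcongr
      _ = N * b ^ 2 * (3 * κ * A ^ 3 + (b * ρ) * (1 + 4 * κ)) := by ring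
      _ = _ := by rw [hbρ]; ring
  have hDo : ‖a ^ 4 • doubletAngular u e h - b ^ 4 • doubletAngular v e g‖ ≤
      N * b ^ 3 * (96 * κ * A ^ 4 + 24 + 108 * κ) := by
    refine (norm_smul_sub_smul_le (by positivity) _ _).trans ?_
    have i1 := abs_pow_four_sub_le ha0.le hb0.le hab hbb hd
    have i2 : ‖doubletAngular u e h‖ ≤ 24 * N :=
      (norm_doubletAngular_le hu1 he.le h).trans (by gcongr)
    have i3 : ‖doubletAngular u e h - doubletAngular v e g‖ ≤
        24 * (N * ρ) + 54 * (2 * κ * ρ) * N := by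
      have e1 : doubletAngular u e h - doubletAngular v e g =
          doubletAngular u e (h - g) + (doubletAngular u e g - doubletAngular v e g) := by
        rw [doubletAngular_sub_right]; abel
      rw [e1]
      refine (norm_add_le _ _).trans (add_le_add ?_ ?_)
      · exact (norm_doubletAngular_le hu1 he.le _).trans (by gcongr; exact hhg.trans (by gcongr))
      · exact (norm_doubletAngular_sub_le hu1 hv1 he.le g).trans (by gcongr)
    calc _ ≤ 4 * (κ * A) * (A * b) ^ 3 * (24 * N)
          + b ^ 4 * (24 * (N * ρ) + 54 * (2 * κ * ρ) * N) := by gcongr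
      _ = N * b ^ 3 * (96 * κ * A ^ 4 + (b * ρ) * (24 + 108 * κ)) := by ring
      _ = _ := by rw [hbρ]; ring
  have hsplit : tractionKernel ε R h e - straightKernel ε τ b T e g - oddKernel ε τ b V T e g =
      (3 / (4 * Real.pi)) • ((ε + m) • (a ^ 3 • dyad u h - b ^ 3 • dyad v g))
        + (ε ^ 2 / (8 * Real.pi)) • (a ^ 4 • doubletAngular u e h - b ^ 4 • doubletAngular v e g)
        + (3 / (4 * Real.pi) * m * b ^ 5 * ε * τ) • (⟪e, g⟫ • T + ⟪T, g⟫ • e) := by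
    rw [tractionKernel_eq ε (norm_pos_iff.1 hR), hRe]
    have := straight_decomposition ε τ b V hTe he g
    rw [sub_sub, eq_sub_of_add_eq this.symm]
    module
  have hc1 : 3 / (4 * Real.pi) ≤ 1 := by rw [div_le_one (by positivity)]; linarith
  have hc2 : ε ^ 2 / (8 * Real.pi) ≤ ε ^ 2 := div_le_self (by positivity) (by linarith)
  set CS := 3 * κ * A ^ 3 + 1 + 4 * κ with hCS
  set CD := 96 * κ * A ^ 4 + 24 + 108 * κ with hCD
  have hA0 : 0 ≤ A := by linarith
  have hCS0 : 0 ≤ CS := by positivity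
  have hCD0 : 0 ≤ CD := by positivity
  have b1 : ‖(3 / (4 * Real.pi)) • ((ε + m) • (a ^ 3 • dyad u h - b ^ 3 • dyad v g))‖ ≤
      N * CS * (ε * b ^ 2 + κ) := by
    rw [norm_smul, norm_smul, Real.norm_of_nonneg (by positivity), Real.norm_eq_abs]
    have i1 : |ε + m| ≤ ε + κ * τ ^ 2 := by
      refine (abs_add_le _ _).trans ?_
      rw [abs_of_pos hε]; gcongr
    calc _ ≤ 1 * ((ε + κ * τ ^ 2) * (N * b ^ 2 * CS)) := by gcongr
      _ = N * CS * (ε * b ^ 2 + κ * (τ ^ 2 * b ^ 2)) := by ring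
      _ ≤ N * CS * (ε * b ^ 2 + κ * 1) := by gcongr
      _ = _ := by ring
  have b2 : ‖(ε ^ 2 / (8 * Real.pi)) •
      (a ^ 4 • doubletAngular u e h - b ^ 4 • doubletAngular v e g)‖ ≤ N * CD * (ε * b ^ 2) := by
    rw [norm_smul, Real.norm_of_nonneg (by positivity)]
    calc _ ≤ ε ^ 2 * (N * b ^ 3 * CD) := by gcongr
      _ = N * CD * (ε * b ^ 2) * (ε * b) := by ring
      _ ≤ N * CD * (ε * b ^ 2) * 1 := by gcongr
      _ = _ := by ring
  -- The even remainder carries an explicit `ε`; `|m| ≤ κ τ²` together with `|τ| b ≤ 1` brings it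
  -- down to `ε b²`.
  have b3 : ‖(3 / (4 * Real.pi) * m * b ^ 5 * ε * τ) • (⟪e, g⟫ • T + ⟪T, g⟫ • e)‖ ≤
      2 * κ * N * (ε * b ^ 2) := by
    rw [norm_smul, Real.norm_eq_abs, abs_mul, abs_mul, abs_mul, abs_mul, abs_of_pos hε,
      abs_of_pos (by positivity : 0 < 3 / (4 * Real.pi)), abs_of_pos (by positivity : 0 < b ^ 5)]
    have i1 : ‖⟪e, g⟫ • T + ⟪T, g⟫ • e‖ ≤ N + N := by
      refine (norm_add_le _ _).trans (add_le_add ?_ ?_)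
      · rw [norm_smul, hT, mul_one]; exact (abs_inner_le_of_norm_le_one he.le g).trans hg
      · rw [norm_smul, he, mul_one]; exact (abs_inner_le_of_norm_le_one hT.le g).trans hg
    calc _ ≤ 1 * (κ * τ ^ 2) * b ^ 5 * ε * |τ| * (N + N) := by gcongr
      _ = 2 * κ * N * (ε * b ^ 2) * ((τ ^ 2 * b ^ 2) * (|τ| * b)) := by ring
      _ ≤ 2 * κ * N * (ε * b ^ 2) * (1 * 1) := by gcongr
      _ = _ := by ring
  rw [hsplit]
  refine norm_add₃_le.trans ((add_le_add (add_le_add b1 b2) b3).trans ?_)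
  exact bound_sum_le hκ hN hCS0 hCD0 (by positivity)

end Estimate

/-! ### Integrals along the straight filament -/

/-- The inverse distance from a point at distance `ε` from a straight filament to the point of the
filament with abscissa `τ`. -/
def invDist (ε τ : ℝ) : ℝ := (√(ε ^ 2 + τ ^ 2))⁻¹

section InvDist

variable {ε : ℝ} (hε : 0 < ε)
include hε

theorem invDist_pos (τ : ℝ) : 0 < invDist ε τ := by unfold invDist; positivity

theorem invDist_sq (τ : ℝ) : invDist ε τ ^ 2 = (ε ^ 2 + τ ^ 2)⁻¹ := by
  rw [invDist, inv_pow, Real.sq_sqrt (by positivity)]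

theorem invDist_sq_mul (τ : ℝ) : invDist ε τ ^ 2 * (ε ^ 2 + τ ^ 2) = 1 := by
  rw [invDist_sq hε, inv_mul_cancel₀ (by positivity)]

theorem continuous_invDist : Continuous (invDist ε) := by
  unfold invDist
  have : ∀ τ : ℝ, √(ε ^ 2 + τ ^ 2) ≠ 0 := fun τ => by positivity
  fun_prop (disch := assumption)

/-- The change of variable `w = τ/√(ε² + τ²)`, under which the straight kernel becomes polynomial.
-/
theorem hasDerivAt_mul_invDist (τ : ℝ) :
    HasDerivAt (fun τ => τ * invDist ε τ) (ε ^ 2 * invDist ε τ ^ 3) τ := by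
  have hpos : 0 < ε ^ 2 + τ ^ 2 := by positivity
  have h1 : HasDerivAt (fun τ : ℝ => ε ^ 2 + τ ^ 2) (2 * τ) τ := by
    simpa using (hasDerivAt_pow 2 τ).const_add (ε ^ 2)
  have h2 : HasDerivAt (invDist ε) (-(2 * τ / (2 * √(ε ^ 2 + τ ^ 2))) / √(ε ^ 2 + τ ^ 2) ^ 2) τ :=
    (h1.sqrt hpos.ne').inv (by positivity)
  refine ((hasDerivAt_id τ).mul h2).congr_deriv ?_
  have hs : √(ε ^ 2 + τ ^ 2) ^ 2 = ε ^ 2 + τ ^ 2 := Real.sq_sqrt hpos.le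
  simp only [invDist, id]
  field_simp
  linear_combination hs

theorem integral_invDist_sq_le (a : ℝ) :
    ∫ τ in (-a)..a, invDist ε τ ^ 2 ≤ Real.pi / ε := by
  have hd : ∀ τ ∈ Set.uIcc (-a) a,
      HasDerivAt (fun τ => Real.arctan (τ / ε) / ε) (invDist ε τ ^ 2) τ := by
    intro τ _
    refine (((hasDerivAt_id τ).div_const ε).arctan.div_const ε).congr_deriv ?_
    rw [invDist_sq hε]
    simp only [id]
    field_simp
  rw [intervalIntegral.integral_eq_sub_of_hasDerivAt hd
    (((continuous_invDist hε).pow 2).intervalIntegrable _ _), ← sub_div]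
  gcongr
  have h1 := Real.arctan_lt_pi_div_two (a / ε)
  have h2 := Real.neg_pi_div_two_lt_arctan (-a / ε)
  linarith

end InvDist

/-- Twice the antiderivative of the even part of the traction of a straight filament, in the
variable `w = τ / √(ε² + τ²)`. -/
def straightPrimitive (w : ℝ) (E D g : E3) : E3 :=
  (3 / (4 * Real.pi)) • ((w - w ^ 3 / 3) • E + (w ^ 3 / 3) • D)
    + (1 / (8 * Real.pi)) • ((3 * (w - w ^ 3 / 3)) • (g + (2 : ℝ) • E)
      - (15 : ℝ) • ((w - 2 * w ^ 3 / 3 + w ^ 5 / 5) • E + (w ^ 3 / 3 - w ^ 5 / 5) • D))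

theorem hasDerivAt_straightPrimitive (w : ℝ) (E D g : E3) :
    HasDerivAt (fun w => straightPrimitive w E D g)
      ((3 / (4 * Real.pi)) • ((1 - w ^ 2) • E + (w ^ 2) • D)
        + (1 / (8 * Real.pi)) • ((3 * (1 - w ^ 2)) • (g + (2 : ℝ) • E)
          - (15 : ℝ) • ((1 - w ^ 2) ^ 2 • E + (w ^ 2 * (1 - w ^ 2)) • D))) w := by
  have h1 : HasDerivAt (fun w : ℝ => w) 1 w := hasDerivAt_id w
  have h3 : HasDerivAt (fun w : ℝ => w ^ 3) (3 * w ^ 2) w := by simpa using hasDerivAt_pow 3 w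
  have h5 : HasDerivAt (fun w : ℝ => w ^ 5) (5 * w ^ 4) w := by simpa using hasDerivAt_pow 5 w
  have i1 : HasDerivAt (fun w : ℝ => w - w ^ 3 / 3) (1 - w ^ 2) w :=
    (h1.sub (h3.div_const 3)).congr_deriv (by ring)
  have i2 : HasDerivAt (fun w : ℝ => w ^ 3 / 3) (w ^ 2) w :=
    (h3.div_const 3).congr_deriv (by ring)
  have i3 : HasDerivAt (fun w : ℝ => w - 2 * w ^ 3 / 3 + w ^ 5 / 5) ((1 - w ^ 2) ^ 2) w :=
    ((h1.sub ((h3.const_mul 2).div_const 3)).add (h5.div_const 5)).congr_deriv (by ring)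
  have i4 : HasDerivAt (fun w : ℝ => w ^ 3 / 3 - w ^ 5 / 5) (w ^ 2 * (1 - w ^ 2)) w :=
    ((h3.div_const 3).sub (h5.div_const 5)).congr_deriv (by ring)
  have j1 := ((i1.smul_const E).add (i2.smul_const D)).const_smul (3 / (4 * Real.pi))
  have j2 := ((i3.smul_const E).add (i4.smul_const D)).const_smul (15 : ℝ)
  have j3 := (((i1.const_mul 3).smul_const (g + (2 : ℝ) • E)).sub j2).const_smul
    (1 / (8 * Real.pi))
  exact j1.add j3

theorem continuous_straightKernel {ε : ℝ} (T g : E3) :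
    Continuous fun p : ℝ × ℝ × E3 => straightKernel ε p.1 p.2.1 T p.2.2 g := by
  unfold straightKernel dyad; fun_prop

theorem continuous_oddKernel {ε : ℝ} (T g : E3) :
    Continuous fun p : ℝ × ℝ × E3 × E3 => oddKernel ε p.1 p.2.1 p.2.2.1 T p.2.2.2 g := by
  unfold oddKernel dyad; fun_prop

theorem integral_straightKernel {ε : ℝ} (hε : 0 < ε) (a : ℝ) (T e g : E3) :
    ε • ∫ τ in (-a)..a, straightKernel ε τ (invDist ε τ) T e g =
      (2 : ℝ) • straightPrimitive (a * invDist ε a) (dyad e g) (dyad T g) g := by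
  have hd : ∀ τ ∈ Set.uIcc (-a) a,
      HasDerivAt (fun τ => straightPrimitive (τ * invDist ε τ) (dyad e g) (dyad T g) g)
        (ε • straightKernel ε τ (invDist ε τ) T e g) τ := by
    intro τ _
    refine ((hasDerivAt_straightPrimitive (τ * invDist ε τ) (dyad e g) (dyad T g) g).scomp τ
      (hasDerivAt_mul_invDist hε τ)).congr_deriv ?_
    set b := invDist ε τ
    -- This relation converts every power of `ε b` and `τ b` in the kernel into a polynomial in `w`.
    have hb : 1 - (τ * b) ^ 2 = ε ^ 2 * b ^ 2 := by
      linear_combination -(invDist_sq_mul hε τ)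
    rw [hb, straightKernel]
    module
  have hc := continuous_invDist hε
  have hi : Continuous fun τ => ε • straightKernel ε τ (invDist ε τ) T e g :=
    ((continuous_straightKernel (ε := ε) T g).comp
      (f := fun τ => (τ, invDist ε τ, e)) (by fun_prop)).const_smul ε
  rw [← intervalIntegral.integral_smul,
    intervalIntegral.integral_eq_sub_of_hasDerivAt hd (hi.intervalIntegrable _ _)]
  have hneg : invDist ε (-a) = invDist ε a := by simp [invDist]
  rw [hneg]
  simp only [straightPrimitive]
  module

/-! ### Averages over the cross section -/

theorem integral_eq_zero_of_antiperiodic {h : ℝ → E3} (hc : Continuous h)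
    (hπ : Function.Antiperiodic h Real.pi) : ∫ θ in (0 : ℝ)..(2 * Real.pi), h θ = 0 := by
  have h1 := intervalIntegral.integral_comp_add_right (a := 0) (b := Real.pi) h Real.pi
  rw [zero_add, ← two_mul] at h1
  rw [← intervalIntegral.integral_add_adjacent_intervals (hc.intervalIntegrable 0 Real.pi)
    (hc.intervalIntegrable Real.pi (2 * Real.pi)), ← h1]
  simp only [hπ _, intervalIntegral.integral_neg, add_neg_cancel]

theorem continuous_eRho (n₁ n₂ : ℝ → E3) (s : ℝ) : Continuous (eRho n₁ n₂ s) := by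
  unfold eRho; fun_prop

/-- The average of `e eᵀ` over the circle is half the projection onto the normal plane, `I - T Tᵀ`;
the mixed term vanishes. -/
theorem integral_dyad_eRho {X n₁ n₂ : ℝ → E3} (hn : IsNormalFrame X n₁ n₂) (s : ℝ) (g : E3) :
    ∫ θ in (0 : ℝ)..(2 * Real.pi), dyad (eRho n₁ n₂ s θ) g =
      Real.pi • (g - dyad (deriv X s) g) := by
  have e1 : ∀ θ, dyad (eRho n₁ n₂ s θ) g = (Real.cos θ ^ 2) • dyad (n₁ s) g
      + (Real.sin θ ^ 2) • dyad (n₂ s) g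
      + (Real.sin θ * Real.cos θ) • (⟪n₁ s, g⟫ • n₂ s + ⟪n₂ s, g⟫ • n₁ s) := by
    intro θ
    simp only [dyad, eRho, inner_add_left, real_inner_smul_left]
    module
  simp only [e1]
  have c1 : Continuous fun θ : ℝ => (Real.cos θ ^ 2) • dyad (n₁ s) g := by fun_prop
  have c2 : Continuous fun θ : ℝ => (Real.sin θ ^ 2) • dyad (n₂ s) g := by fun_prop
  have c3 : Continuous fun θ : ℝ =>
    (Real.sin θ * Real.cos θ) • (⟪n₁ s, g⟫ • n₂ s + ⟪n₂ s, g⟫ • n₁ s) := by fun_prop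
  have c12 : Continuous fun θ : ℝ =>
    (Real.cos θ ^ 2) • dyad (n₁ s) g + (Real.sin θ ^ 2) • dyad (n₂ s) g := c1.add c2
  rw [intervalIntegral.integral_add (c12.intervalIntegrable _ _)
    (c3.intervalIntegrable _ _), intervalIntegral.integral_add (c1.intervalIntegrable _ _)
    (c2.intervalIntegrable _ _), intervalIntegral.integral_smul_const,
    intervalIntegral.integral_smul_const, intervalIntegral.integral_smul_const,
    integral_cos_sq, integral_sin_sq, integral_sin_mul_cos₁]
  have e2 : g - dyad (deriv X s) g = dyad (n₁ s) g + dyad (n₂ s) g := by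
    nth_rewrite 1 [hn.expansion s g]
    simp only [dyad]; abel
  rw [e2]
  simp

/-- At `w = 1`, the infinite filament, the right side is exactly `g`: the Stokeslet part alone gives
`g` and the doublet part averages to zero. -/
theorem integral_straightPrimitive_eRho {X n₁ n₂ : ℝ → E3} (hn : IsNormalFrame X n₁ n₂) (s w : ℝ)
    (g : E3) :
    ∫ θ in (0 : ℝ)..(2 * Real.pi),
        (2 : ℝ) • straightPrimitive w (dyad (eRho n₁ n₂ s θ) g) (dyad (deriv X s) g) g =
      (3 / 4 * w + w ^ 3 - 3 / 4 * w ^ 5) • g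
        + (3 / 4 * w * (1 - w ^ 2) * (1 - 3 * w ^ 2)) • dyad (deriv X s) g := by
  have hpi := Real.pi_ne_zero
  set D := dyad (deriv X s) g with hD
  have e1 : ∀ E : E3, (2 : ℝ) • straightPrimitive w E D g =
      (3 / (2 * Real.pi) * (w - w ^ 3 / 3) + 1 / (4 * Real.pi) * (6 * (w - w ^ 3 / 3)
        - 15 * (w - 2 * w ^ 3 / 3 + w ^ 5 / 5))) • E
      + ((3 / (2 * Real.pi) * (w ^ 3 / 3) - 1 / (4 * Real.pi) * (15 * (w ^ 3 / 3 - w ^ 5 / 5))) • D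
        + (1 / (4 * Real.pi) * (3 * (w - w ^ 3 / 3))) • g) := by
    intro E
    simp only [straightPrimitive]
    match_scalars <;> field_simp <;> ring
  have c1 : Continuous fun θ => dyad (eRho n₁ n₂ s θ) g := by
    have := continuous_eRho n₁ n₂ s
    unfold dyad; fun_prop
  simp only [e1]
  rw [intervalIntegral.integral_add (Continuous.intervalIntegrable (by fun_prop) _ _)
    intervalIntegrable_const, intervalIntegral.integral_smul, integral_dyad_eRho hn, ← hD,
    intervalIntegral.integral_const]
  match_scalars <;> field_simp <;> ring

/-- Both the coefficient of `g` minus `1` and the coefficient of the dyad are small because `1 - w²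
= ε² / (ε² + 1/4) ≤ 4 ε²`, which is at most `ε` when `ε ≤ 1/4`. -/
theorem norm_straight_sub_le {ε : ℝ} (hε : 0 < ε) (hε1 : ε ≤ 1 / 4) {T g : E3} (hT : ‖T‖ = 1)
    {w : ℝ} (hw : w = 1 / 2 * invDist ε (1 / 2)) :
    ‖(3 / 4 * w + w ^ 3 - 3 / 4 * w ^ 5) • g
        + (3 / 4 * w * (1 - w ^ 2) * (1 - 3 * w ^ 2)) • dyad T g - g‖ ≤ 9 * ε * ‖g‖ := by
  have hw0 : 0 ≤ w := by rw [hw]; have := invDist_pos hε (1 / 2); positivity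
  have hq := invDist_sq_mul hε (1 / 2)
  have hb2 : invDist ε (1 / 2) ^ 2 ≤ 4 := by nlinarith [sq_nonneg (ε * invDist ε (1 / 2))]
  have hw2 : 1 - w ^ 2 = ε ^ 2 * invDist ε (1 / 2) ^ 2 := by
    rw [hw]; linear_combination -hq
  have h1 : 1 - w ^ 2 ≤ ε := by
    rw [hw2]
    calc ε ^ 2 * invDist ε (1 / 2) ^ 2 ≤ ε ^ 2 * 4 := by gcongr
      _ ≤ ε := by nlinarith
  have h0 : 0 ≤ 1 - w ^ 2 := by rw [hw2]; positivity
  have hw1 : w ≤ 1 := by nlinarith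
  have hd : 1 - w ≤ ε := by nlinarith
  have e1 : (3 / 4 * w + w ^ 3 - 3 / 4 * w ^ 5) • g
        + (3 / 4 * w * (1 - w ^ 2) * (1 - 3 * w ^ 2)) • dyad T g - g =
      ((1 - w ^ 2) * (3 / 4 * w * (1 + w ^ 2)) - (1 - w) * (1 + w + w ^ 2)) • g
        + ((1 - w ^ 2) * (3 / 4 * w * (1 - 3 * w ^ 2))) • dyad T g := by module
  have hww : w ^ 2 ≤ 1 := by linarith
  have a1 : |(1 - w ^ 2) * (3 / 4 * w * (1 + w ^ 2)) - (1 - w) * (1 + w + w ^ 2)| ≤ 5 * ε := by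
    have i1 : (1 - w ^ 2) * (3 / 4 * w * (1 + w ^ 2)) ≤ ε * (3 / 4 * 1 * (1 + 1)) := by gcongr
    have i2 : (1 - w) * (1 + w + w ^ 2) ≤ ε * (1 + 1 + 1) := by gcongr
    have i3 : 0 ≤ (1 - w ^ 2) * (3 / 4 * w * (1 + w ^ 2)) := by positivity
    have i4 : 0 ≤ (1 - w) * (1 + w + w ^ 2) := mul_nonneg (by linarith) (by positivity)
    rw [abs_le]; constructor <;> linarith
  have a2 : |(1 - w ^ 2) * (3 / 4 * w * (1 - 3 * w ^ 2))| ≤ 4 * ε := by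
    rw [abs_mul, abs_mul, abs_of_nonneg h0, abs_of_nonneg (by positivity : 0 ≤ 3 / 4 * w)]
    have i1 : |1 - 3 * w ^ 2| ≤ 2 := by rw [abs_le]; constructor <;> nlinarith
    calc (1 - w ^ 2) * (3 / 4 * w * |1 - 3 * w ^ 2|) ≤ ε * (3 / 4 * 1 * 2) := by gcongr
      _ ≤ 4 * ε := by linarith
  rw [e1]
  refine (norm_add_le _ _).trans ?_
  rw [norm_smul, norm_smul, Real.norm_eq_abs, Real.norm_eq_abs]
  calc _ ≤ 5 * ε * ‖g‖ + 4 * ε * ‖g‖ := by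
        gcongr
        exact norm_dyad_le hT.le g
    _ = 9 * ε * ‖g‖ := by ring

/-! ### The total force -/

/-- The constant in the comparison of `forceSB` with the prescribed force density. -/
def forceConst (cΓ κ : ℝ) : ℝ :=
  9 + 2 * Real.pi * (kernelConst κ (3 / min 1 cΓ) * (Real.pi + 1)
    + 2 * κ * (3 / min 1 cΓ) ^ 2 * Real.pi)

theorem norm_jacobian_sub_le {X n₁ n₂ : ℝ → E3} (hX : IsCenterline X) (hn : IsNormalFrame X n₁ n₂)
    {ε : ℝ} (hε : 0 < ε) (s θ : ℝ) :
    |jacobian X n₁ n₂ ε s θ - ε| ≤ ε ^ 2 * maxCurvature X := by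
  have e1 : jacobian X n₁ n₂ ε s θ - ε = -(ε ^ 2 * ⟪deriv (deriv X) s, eRho n₁ n₂ s θ⟫) := by
    simp only [jacobian, eRho, inner_add_right, real_inner_smul_right]; ring
  rw [e1, abs_neg, abs_mul, abs_of_nonneg (by positivity : 0 ≤ ε ^ 2)]
  gcongr
  refine (abs_real_inner_le_norm _ _).trans ?_
  rw [hn.norm_eRho, mul_one]
  exact hX.norm_deriv_deriv_le s

theorem integral_comp_sub_left_half {E : Type*} [NormedAddCommGroup E] [NormedSpace ℝ E]
    (h : ℝ → E) (s : ℝ) :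
    ∫ t in (s - 1 / 2)..(s + 1 / 2), h (s - t) = ∫ τ in (-(1 / 2))..(1 / 2), h τ := by
  rw [intervalIntegral.integral_comp_sub_left]
  congr 1 <;> ring

theorem inv_dist_le {cΓ ε x r : ℝ} (hc : 0 < cΓ) (hε : 0 < ε) (τ : ℝ)
    (hr : r = √(ε ^ 2 + τ ^ 2)) (hx : (ε + cΓ * |τ|) / 3 ≤ x) :
    r ≤ 3 / min 1 cΓ * x := by
  have hm : 0 < min 1 cΓ := lt_min one_pos hc
  have h1 : r ≤ ε + |τ| := by
    rw [hr, Real.sqrt_le_left (by positivity)]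
    nlinarith [abs_nonneg τ, sq_abs τ]
  have h2 : min 1 cΓ * (ε + |τ|) ≤ ε + cΓ * |τ| := by
    have i1 : min 1 cΓ * ε ≤ 1 * ε := by gcongr; exact min_le_left _ _
    have i2 : min 1 cΓ * |τ| ≤ cΓ * |τ| := by gcongr; exact min_le_right _ _
    linarith
  rw [div_mul_eq_mul_div, le_div_iff₀ hm]
  nlinarith

-- The inner integral `K` is split into the straight part `K₀`, the odd part `K₁` and a remainder.
-- `K₀` yields `f s + O(ε)`, `K₁` disappears over the circle, and the remainder and the Jacobian
-- correction are `O(ε)` for each `θ`.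
set_option maxHeartbeats 1000000 in
theorem norm_forceSB_sub_le {X n₁ n₂ f : ℝ → E3} {cΓ r ε : ℝ} (hX : IsCenterline X)
    (hΓ : NonSelfIntersecting X cΓ) (hn : IsNormalFrame X n₁ n₂) (hr : IsTubeRadius X n₁ n₂ r)
    (hε : 0 < ε) (hεr : ε < r / 4) (hf : ContDiff ℝ 1 f) (hfp : Function.Periodic f 1) (s : ℝ) :
    ‖forceSB X n₁ n₂ f ε s - f s‖ ≤ forceConst cΓ (maxCurvature X) * ε * normC1 f := by
  have hr1 := tubeRadius_le_one hX hΓ hn hr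
  have hε4 : ε ≤ 1 / 4 := by linarith
  have hεr' : ε < r := by linarith
  have hκ := maxCurvature_nonneg X
  have hN := normC1_nonneg f
  have hpi := Real.pi_pos
  set κ := maxCurvature X with hκdef
  set N := normC1 f with hNdef
  set A := 3 / min 1 cΓ with hAdef
  have hA1 : 1 ≤ A := by
    rw [hAdef, le_div_iff₀ (lt_min one_pos hΓ.1)]
    linarith [min_le_left 1 cΓ]
  set e := eRho n₁ n₂ s with hedef
  have hec : Continuous e := continuous_eRho n₁ n₂ s
  have hXc := hX.continuous
  have hfc := hf.continuous
  have hbc := continuous_invDist hε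
  have hsurf : ∀ θ t, surfacePoint X n₁ n₂ ε s θ - X t = X s - X t + ε • e θ := by
    intro θ t; rw [surfacePoint]; abel
  have hεR : ∀ θ t, ε ≤ ‖X s - X t + ε • e θ‖ := by
    intro θ t; rw [← hsurf]; exact le_norm_surfacePoint_sub hX hn hr hε hεr' s θ t
  set k : ℝ → ℝ → E3 := fun θ t => tractionKernel ε (X s - X t + ε • e θ) (f t) (e θ) with hk
  set k₀ : ℝ → ℝ → E3 := fun θ t =>
    straightKernel ε (s - t) (invDist ε (s - t)) (deriv X s) (e θ) (f s) with hk₀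
  set k₁ : ℝ → ℝ → E3 := fun θ t =>
    oddKernel ε (s - t) (invDist ε (s - t)) (X s - X t) (deriv X s) (e θ) (f s) with hk₁
  have hkc : Continuous (Function.uncurry k) :=
    (continuousOn_tractionKernel ε).comp_continuous
      (f := fun p : ℝ × ℝ => (X s - X p.2 + ε • e p.1, f p.2, e p.1)) (by fun_prop)
      fun p => norm_pos_iff.1 (hε.trans_le (hεR p.1 p.2))
  have hk₀c : Continuous (Function.uncurry k₀) :=
    (continuous_straightKernel (ε := ε) (deriv X s) (f s)).comp
      (f := fun p : ℝ × ℝ => (s - p.2, invDist ε (s - p.2), e p.1)) (by fun_prop)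
  have hk₁c : Continuous (Function.uncurry k₁) :=
    (continuous_oddKernel (ε := ε) (deriv X s) (f s)).comp
      (f := fun p : ℝ × ℝ => (s - p.2, invDist ε (s - p.2), X s - X p.2, e p.1)) (by fun_prop)
  set K : ℝ → E3 := fun θ => ∫ t in (s - 1 / 2)..(s + 1 / 2), k θ t with hK
  set K₀ : ℝ → E3 := fun θ => ∫ t in (s - 1 / 2)..(s + 1 / 2), k₀ θ t with hK₀
  set K₁ : ℝ → E3 := fun θ => ∫ t in (s - 1 / 2)..(s + 1 / 2), k₁ θ t with hK₁
  have hKc : Continuous K :=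
    intervalIntegral.continuous_parametric_intervalIntegral_of_continuous' hkc _ _
  have hK₀c : Continuous K₀ :=
    intervalIntegral.continuous_parametric_intervalIntegral_of_continuous' hk₀c _ _
  have hK₁c : Continuous K₁ :=
    intervalIntegral.continuous_parametric_intervalIntegral_of_continuous' hk₁c _ _
  have hforce : forceSB X n₁ n₂ f ε s =
      ∫ θ in (0 : ℝ)..(2 * Real.pi), jacobian X n₁ n₂ ε s θ • K θ := by
    unfold forceSB
    refine intervalIntegral.integral_congr fun θ _ => ?_
    rw [stress_apply_neg ε hXc hfc hε
      (fun t => le_norm_surfacePoint_sub hX hn hr hε hεr' s θ t)]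
    congr 1
    -- Periodicity moves the integration to the window centred at `s`, so that `|τ| ≤ 1/2` and the
    -- interval is symmetric in `τ`.
    have hper : Function.Periodic (k θ) 1 := by
      intro t; simp only [hk, hX.periodic t, hfp t]
    have h := hper.intervalIntegral_add_eq 0 (s - 1 / 2)
    rw [zero_add, show s - 1 / 2 + 1 = s + 1 / 2 by ring] at h
    simp only [hK]
    rw [← h]
    refine intervalIntegral.integral_congr fun t _ => ?_
    simp only [hk, hsurf, hedef]
  have hab : s - 1 / 2 ≤ s + 1 / 2 := by linarith
  have habs : ∀ t ∈ Set.Ioc (s - 1 / 2) (s + 1 / 2), |s - t| ≤ 1 / 2 := by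
    intro t ht; rw [abs_le]; constructor <;> linarith [ht.1, ht.2]
  have hAR : ∀ θ, ∀ t ∈ Set.Ioc (s - 1 / 2) (s + 1 / 2),
      √(ε ^ 2 + (s - t) ^ 2) ≤ A * ‖X s - X t + ε • e θ‖ := by
    intro θ t ht
    refine inv_dist_le hΓ.1 hε (s - t) rfl ?_
    rw [← hsurf]
    exact add_le_norm_surfacePoint_sub hX hΓ hn hr hε hεr' s θ (habs t ht)
  have hsqpos : ∀ t, 0 < √(ε ^ 2 + (s - t) ^ 2) := fun t => by positivity
  have hbi : ∫ t in (s - 1 / 2)..(s + 1 / 2), invDist ε (s - t) ^ 2 ≤ Real.pi / ε := by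
    rw [integral_comp_sub_left_half (fun τ => invDist ε τ ^ 2)]
    exact integral_invDist_sq_le hε _
  have hbii : ∀ c d : ℝ, IntervalIntegrable (fun t => invDist ε (s - t) ^ 2)
      MeasureTheory.volume c d := fun c d => Continuous.intervalIntegrable (by fun_prop) c d
  have hKbd : ∀ θ, ‖K θ‖ ≤ 2 * N * A ^ 2 * (Real.pi / ε) := by
    intro θ
    refine (intervalIntegral.norm_integral_le_of_norm_le hab
      (g := fun t => 2 * N * A ^ 2 * invDist ε (s - t) ^ 2)
      (MeasureTheory.ae_of_all _ fun t ht => ?_) ((hbii _ _).const_mul _)).trans ?_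
    · exact norm_tractionKernel_le hε (hεR θ t) (hsqpos t) (hAR θ t ht) (hn.norm_eRho s θ)
        (norm_le_normC1 hf hfp t)
    · rw [intervalIntegral.integral_const_mul]; gcongr
  set C := kernelConst κ A with hC
  have hC0 : 0 ≤ C := by
    have : 0 ≤ A := by linarith
    rw [hC, kernelConst]; positivity
  have hdiff : ∀ θ, ‖K θ - K₀ θ - K₁ θ‖ ≤ C * N * (Real.pi + 1) := by
    intro θ
    have hkθ : Continuous (k θ) := hkc.uncurry_left θ
    have hk₀θ : Continuous (k₀ θ) := hk₀c.uncurry_left θ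
    have hk₁θ : Continuous (k₁ θ) := hk₁c.uncurry_left θ
    have e1 : K θ - K₀ θ - K₁ θ =
        ∫ t in (s - 1 / 2)..(s + 1 / 2), (k θ t - k₀ θ t - k₁ θ t) := by
      have hd : Continuous fun t => k θ t - k₀ θ t := hkθ.sub hk₀θ
      rw [intervalIntegral.integral_sub (hd.intervalIntegrable _ _)
        (hk₁θ.intervalIntegrable _ _), intervalIntegral.integral_sub
        (hkθ.intervalIntegrable _ _) (hk₀θ.intervalIntegrable _ _)]
    rw [e1]
    refine (intervalIntegral.norm_integral_le_of_norm_le hab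
      (g := fun t => C * N * (ε * invDist ε (s - t) ^ 2 + 1))
      (MeasureTheory.ae_of_all _ fun t ht => ?_)
      ((((hbii _ _).const_mul _).add intervalIntegrable_const).const_mul _)).trans ?_
    · refine norm_tractionKernel_sub_le hε hκ hA1 (hsqpos t) (Real.sq_sqrt (by positivity))
        (hX.norm_sub_sub_smul_deriv_le s t) (hAR θ t ht) (hX.arclength s) (hn.norm_eRho s θ)
        (hn.inner_tangent_eRho s θ) (norm_le_normC1 hf hfp s) (norm_le_normC1 hf hfp t) ?_
      rw [abs_sub_comm]
      exact norm_sub_le_normC1 hf hfp s t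
    · rw [intervalIntegral.integral_const_mul, intervalIntegral.integral_add
        ((hbii _ _).const_mul _) intervalIntegrable_const, intervalIntegral.integral_const_mul,
        intervalIntegral.integral_const]
      have h1 : ε * ∫ t in (s - 1 / 2)..(s + 1 / 2), invDist ε (s - t) ^ 2 ≤ Real.pi := by
        rw [← le_div_iff₀' hε]; exact hbi
      have h2 : (s + 1 / 2 - (s - 1 / 2)) • (1 : ℝ) = 1 := by rw [smul_eq_mul]; ring
      rw [h2]
      gcongr
  -- Replacing `θ` by `θ + π` flips the sign of `e`, so opposite points of the cross section cancel.
  have hK₁zero : ∫ θ in (0 : ℝ)..(2 * Real.pi), K₁ θ = 0 := by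
    refine integral_eq_zero_of_antiperiodic hK₁c fun θ => ?_
    simp only [hK₁, hk₁, hedef, eRho_add_pi, oddKernel_neg, intervalIntegral.integral_neg]
  set w := 1 / 2 * invDist ε (1 / 2) with hw
  have hK₀int : ∀ θ, ε • K₀ θ =
      (2 : ℝ) • straightPrimitive w (dyad (e θ) (f s)) (dyad (deriv X s) (f s)) (f s) := by
    intro θ
    simp only [hK₀, hk₀]
    rw [integral_comp_sub_left_half (fun τ =>
      straightKernel ε τ (invDist ε τ) (deriv X s) (e θ) (f s)), integral_straightKernel hε]
  have hmain : ‖(∫ θ in (0 : ℝ)..(2 * Real.pi), ε • K₀ θ) - f s‖ ≤ 9 * ε * N := by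
    simp only [hK₀int, hedef]
    rw [integral_straightPrimitive_eRho hn]
    refine (norm_straight_sub_le hε hε4 (hX.arclength s) hw).trans ?_
    gcongr
    exact norm_le_normC1 hf hfp s
  have hJc : Continuous (jacobian X n₁ n₂ ε s) := by unfold jacobian; fun_prop
  -- The first term is `ε` times the bounded kernel error. The second is a Jacobian deviation at
  -- most `κ ε²` against `K = O(1/ε)`.
  set Err : ℝ → E3 := fun θ =>
    ε • (K θ - K₀ θ - K₁ θ) + (jacobian X n₁ n₂ ε s θ - ε) • K θ with hErr
  have hErrc : Continuous Err := by fun_prop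
  have hErrbd : ∀ θ, ‖Err θ‖ ≤ ε * N * (C * (Real.pi + 1) + 2 * κ * A ^ 2 * Real.pi) := by
    intro θ
    refine (norm_add_le _ _).trans ?_
    rw [norm_smul, norm_smul, Real.norm_of_nonneg hε.le, Real.norm_eq_abs]
    calc _ ≤ ε * (C * N * (Real.pi + 1)) + ε ^ 2 * κ * (2 * N * A ^ 2 * (Real.pi / ε)) := by
          gcongr
          · exact hdiff θ
          · exact norm_jacobian_sub_le hX hn hε s θ
          · exact hKbd θ
      _ = _ := by field_simp
  have hsplit : forceSB X n₁ n₂ f ε s - f s =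
      ((∫ θ in (0 : ℝ)..(2 * Real.pi), ε • K₀ θ) - f s)
        + ∫ θ in (0 : ℝ)..(2 * Real.pi), Err θ := by
    have e1 : ∀ θ, jacobian X n₁ n₂ ε s θ • K θ = ε • K₀ θ + ε • K₁ θ + Err θ := by
      intro θ; simp only [hErr]; module
    rw [hforce]
    simp only [e1]
    have c0 : Continuous fun θ => ε • K₀ θ := hK₀c.const_smul ε
    have c1 : Continuous fun θ => ε • K₁ θ := hK₁c.const_smul ε
    have c01 : Continuous fun θ => ε • K₀ θ + ε • K₁ θ := c0.add c1
    rw [intervalIntegral.integral_add (c01.intervalIntegrable _ _)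
      (hErrc.intervalIntegrable _ _), intervalIntegral.integral_add (c0.intervalIntegrable _ _)
      (c1.intervalIntegrable _ _), intervalIntegral.integral_smul ε K₁, hK₁zero]
    module
  have hErrint := intervalIntegral.norm_integral_le_of_norm_le_const (a := 0) (b := 2 * Real.pi)
    (f := Err) fun θ _ => hErrbd θ
  rw [sub_zero, abs_of_pos (by positivity)] at hErrint
  rw [hsplit]
  refine (norm_add_le _ _).trans ((add_le_add hmain hErrint).trans (le_of_eq ?_))
  rw [forceConst, ← hAdef, ← hC]
  ring

end SlenderBody

end

theorem mainTheorem7 :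
    ∃ c : ℝ → ℝ → ℝ,
      ∀ (X n₁ n₂ : ℝ → SlenderBody.E3) (cΓ r ε : ℝ) (f : ℝ → SlenderBody.E3),
        SlenderBody.IsCenterline X →
        SlenderBody.NonSelfIntersecting X cΓ →
        SlenderBody.IsNormalFrame X n₁ n₂ →
        SlenderBody.IsTubeRadius X n₁ n₂ r →
        0 < ε → ε < r / 4 →
        ContDiff ℝ 1 f → Function.Periodic f 1 →
        ∀ s : ℝ,
          ‖SlenderBody.forceSB X n₁ n₂ f ε s - f s‖ ≤
            c cΓ (SlenderBody.maxCurvature X) * ε * SlenderBody.normC1 f := by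
  refine ⟨SlenderBody.forceConst, fun X n₁ n₂ cΓ r ε f hX hΓ hn hr hε hεr hf hfp s => ?_⟩
  exact SlenderBody.norm_forceSB_sub_le hX hΓ hn hr hε hεr hf hfp s
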